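/- Let $n$ be a positive integer and let $O(n)=\{U\in\mathbb{R}^{n\times n}:U^{\top}U=I_n\}$ be the full orthogonal group, a smooth manifold of dimension $d=n(n-1)/2$. For $U\in O(n)$ let $u_j$ be the $j$-th column of $U$ and $\mathrm{d}u_j$ its differential, and let $$\wedge[U^{\top}\mathrm{d}U]:=\bigwedge_{i>j}\langle u_i,\mathrm{d}u_j\rangle$$ be the wedge product of the entries of $U^{\top}\mathrm{d}U$ strictly below the diagonal, a form of degree $d$. With signs ignored it defines a measure on $O(n)$: whenever $W\subseteq\mathbb{R}^d$ is open, $\varphi:W\to O(n)$ is smooth and injective with linearly independent partial derivatives at every point, and $B\subseteq W$ is Borel, $$\int_{\varphi(B)}\wedge[U^{\top}\mathrm{d}U]=\int_B\Bigl|\det\Bigl[\bigl(\varphi(x)^{\top}\,\partial_q\varphi(x)\bigr)_{ij}\Bigr]_{q,\,(i>j)}\Bigr|\,\mathrm{d}x .$$ Then the volume of $O(n)$, i.e. the total mass of this measure, is $$\mathrm{vol}(O(n))=\int_{O(n)}\wedge[U^{\top}\mathrm{d}U]=\frac{2^n\pi^{n^2/2}}{\Gamma_n(n/2)}=\frac{2^n\pi^{n(n+1)/4}}{\prod_{k=1}^n\Gamma(k/2)},$$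 where $$\Gamma_n(\alpha)=\int_{S>0}\det(S)^{\alpha-\frac{n+1}{2}}e^{-\operatorname{tr}S}\prod_{i\ge j}\mathrm{d}s_{ij}\qquad\Bigl(\alpha>\tfrac{n-1}{2}\Bigr)$$ is the real multivariate gamma function, the integral being over the real symmetric positive definite $n\times n$ matrices $S=[s_{ij}]$. -/

import Mathlib

open MeasureTheory
open scoped ContDiff Matrix

noncomputable section

/-- The index pairs `(i, j)` with `j < i`, i.e. the places strictly below the diagonal.
There are `n (n - 1) / 2` of them, which is the dimension of the orthogonal group. -/
abbrev StrictLower (n : ℕ) : Type := {p : Fin n × Fin n // p.2 < p.1}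

/-- The index pairs `(i, j)` with `j ≤ i`: the independent entries of a symmetric matrix. -/
abbrev WeakLower (n : ℕ) : Type := {p : Fin n × Fin n // p.2 ≤ p.1}

/-- The orthogonal group `O(n)` as a set of real `n × n` matrices. -/
def orthogonalSet (n : ℕ) : Set (Matrix (Fin n) (Fin n) ℝ) := {U | Uᵀ * U = 1}

/-- The `(i, j)` entry `⟨u_i, du_j⟩` of the matrix `Uᵀ dU` of differential one-forms at the
point `U`: the linear functional that sends a tangent vector `H` to `(Uᵀ H)_{ij}`. -/
def entryForm {n : ℕ} (U : Matrix (Fin n) (Fin n) ℝ) (i j : Fin n) :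
    Matrix (Fin n) (Fin n) ℝ →ₗ[ℝ] ℝ where
  toFun H := (Uᵀ * H) i j
  map_add' H K := by simp [Matrix.mul_add]
  map_smul' c H := by simp

/-- The wedge product `⋀_{i > j} ⟨u_i, du_j⟩` of the entries of `Uᵀ dU` strictly below the
diagonal, as an alternating form of degree `n (n - 1) / 2` at the point `U`. The wedge product
of one-forms `ω_p` takes the value `det (ω_p (H_q))` on the vectors `H_q`. -/
def wedgeForm {n : ℕ} (U : Matrix (Fin n) (Fin n) ℝ) :
    Matrix (Fin n) (Fin n) ℝ [⋀^StrictLower n]→ₗ[ℝ] ℝ :=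
  (Matrix.detRowAlternating (R := ℝ) (n := StrictLower n)).compLinearMap
    (LinearMap.pi fun p : StrictLower n => entryForm U p.1.1 p.1.2)

theorem wedgeForm_apply {n : ℕ} (U : Matrix (Fin n) (Fin n) ℝ)
    (H : StrictLower n → Matrix (Fin n) (Fin n) ℝ) :
    wedgeForm U H =
      (Matrix.of fun q p : StrictLower n => (Uᵀ * H q) p.1.1 p.1.2).det := rfl

/-- The matrix of partial derivatives `∂φ/∂x_q = [∂φ_{ij}/∂x_q]` of a matrix-valued function. -/
def partialMatrix {n : ℕ} (φ : (StrictLower n → ℝ) → Matrix (Fin n) (Fin n) ℝ)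
    (x : StrictLower n → ℝ) (q : StrictLower n) : Matrix (Fin n) (Fin n) ℝ :=
  Matrix.of fun i j => fderiv ℝ (fun y => φ y i j) x (Pi.single q 1)

/-- `φ` restricted to `W` is a smooth local parametrization of `O(n)`: `W` is open in the space
`ℝ^{n (n - 1) / 2}`, and `φ` maps `W` into `O(n)`, is smooth and injective on `W`, and its partial
derivatives are linearly independent at every point of `W`. (As the dimensions agree, these are
exactly the inverses of the smooth charts of `O(n)`.) -/
structure IsLocalParametrization {n : ℕ} (W : Set (StrictLower n → ℝ))
    (φ : (StrictLower n → ℝ) → Matrix (Fin n) (Fin n) ℝ) : Prop where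
  isOpen : IsOpen W
  mapsTo : Set.MapsTo φ W (orthogonalSet n)
  smooth : ∀ i j, ContDiffOn ℝ ∞ (fun x => φ x i j) W
  injOn : Set.InjOn φ W
  immersion : ∀ x ∈ W, LinearIndependent ℝ (partialMatrix φ x)

/-- The absolute value of the coefficient of the pullback of `⋀ [Uᵀ dU]` along `U = φ(x)`,
that is, of the function `f` in `φ^* (⋀ [Uᵀ dU]) = f(x) ⋀_q dx_q` (signs are ignored). -/
def wedgeDensity {n : ℕ} (φ : (StrictLower n → ℝ) → Matrix (Fin n) (Fin n) ℝ)
    (x : StrictLower n → ℝ) : ENNReal :=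
  ENNReal.ofReal |wedgeForm (φ x) (partialMatrix φ x)|

/-- The Borel sigma-algebra of the space of matrices (product of the real lines of entries). -/
instance matrixMeasurableSpace (n : ℕ) : MeasurableSpace (Matrix (Fin n) (Fin n) ℝ) :=
  inferInstanceAs (MeasurableSpace (Fin n → Fin n → ℝ))

/-- The measure that `|⋀ [Uᵀ dU]|` induces on the part `φ(W)` of `O(n)`: a set `A` has the mass
`∫_{W ∩ φ⁻¹(A)} |φ^* (⋀ [Uᵀ dU])|`. -/
def patchMeasure {n : ℕ} (W : Set (StrictLower n → ℝ))
    (φ : (StrictLower n → ℝ) → Matrix (Fin n) (Fin n) ℝ) :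
    Measure (Matrix (Fin n) (Fin n) ℝ) :=
  Measure.map φ ((volume.restrict W).withDensity (wedgeDensity φ))

/-- The measure `A ↦ ∫_{A ∩ O(n)} |⋀ [Uᵀ dU]|`, glued from the local parametrizations of `O(n)`:
the least measure that dominates every `patchMeasure`. -/
def wedgeMeasure (n : ℕ) : Measure (Matrix (Fin n) (Fin n) ℝ) :=
  ⨆ (W : Set (StrictLower n → ℝ)) (φ : (StrictLower n → ℝ) → Matrix (Fin n) (Fin n) ℝ)
    (_ : IsLocalParametrization W φ), patchMeasure W φ

/-- The volume `∫_{O(n)} ⋀ [Uᵀ dU]` of the full orthogonal group. -/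
def orthogonalVolume (n : ℕ) : ENNReal := wedgeMeasure n (orthogonalSet n)

/-- The symmetric matrix with the given entries on and below the diagonal. -/
def symmetricOf {n : ℕ} (x : WeakLower n → ℝ) : Matrix (Fin n) (Fin n) ℝ :=
  Matrix.of fun i j => x ⟨(max i j, min i j), min_le_max⟩

/-- The real multivariate gamma function
`Γ_n(α) = ∫_{S > 0} det(S)^{α - (n + 1) / 2} e^{- tr S} [dS]`, an integral over the symmetric
positive definite matrices with `[dS] = ∏_{i ≥ j} ds_{ij}`. It converges for `α > (n - 1) / 2`. -/
def multivariateGamma (n : ℕ) (α : ℝ) : ℝ :=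
  ∫ x in {x : WeakLower n → ℝ | (symmetricOf x).PosDef},
    (symmetricOf x).det ^ (α - ((n : ℝ) + 1) / 2) * Real.exp (-(symmetricOf x).trace)

end

/-!
The volume is computed from the QR decomposition of a (not normalized) Gaussian random matrix.

Every invertible real matrix is uniquely `U Lᵀ` with `U` orthogonal and `L` lower triangular with
positive diagonal (`exists_qr`, `qr_unique`). If `φ` is a local parametrization of `O(n)`, then
`(x, L) ↦ φ(x) Lᵀ` is an injective map from an open set of dimension `n ^ 2` into the matrices.
Multiplying its differential by the orthogonal matrix `φ(x)ᵀ` makes it block triangular, so its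
Jacobian is the coefficient of `φ^* (⋀ [Uᵀ dU])` times a product of diagonal entries of `L`
(`abs_det_qr_differential`). The change of variables formula for `exp (- tr (Xᵀ X)) dX` thus shows
that the distribution `qrMeasure` of the factor `U` satisfies
`qrMeasure (φ(B)) = (∫_B |φ^* (⋀ [Uᵀ dU])|) * T`, where `T = triangularMass n` is a constant that
does not depend on `φ` (`qrMeasure_image`). Since `qrMeasure` is one global measure, the patch
measures fit together, and `wedgeMeasure` is `T⁻¹ • qrMeasure` on the range of each
parametrization; transition maps never have to be discussed. Countably many Cayley
parametrizations cover `O(n)`, and singular matrices form a null set, so the volume of `O(n)` is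
`T⁻¹ ∫ exp (- tr (Xᵀ X)) dX = π ^ (n² / 2) / T` (`orthogonalVolume_eq`, `gaussMeasure_univ`).

The constant `T` is evaluated twice. The Cholesky substitution `S = L Lᵀ` turns `Γ_n(n / 2)` into
`2 ^ n * T` (`multivariateGamma_half`), and as the integrand of `T` is a product over the entries
of `L`, Fubini's theorem and one-dimensional integrals express `T` by values of the gamma function
(`integral_triangularWeight`).
-/

/-! ### Triangular factorizations -/

/-- The lower triangular matrix with the given entries on and below the diagonal. -/
def lowerOf {n : ℕ} (y : WeakLower n → ℝ) : Matrix (Fin n) (Fin n) ℝ :=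
  Matrix.of fun i j => if h : j ≤ i then y ⟨(i, j), h⟩ else 0

theorem lowerOf_of_le {n : ℕ} (y : WeakLower n → ℝ) {i j : Fin n} (h : j ≤ i) :
    lowerOf y i j = y ⟨(i, j), h⟩ := by
  simp [lowerOf, h]

theorem lowerOf_of_lt {n : ℕ} (y : WeakLower n → ℝ) {i j : Fin n} (h : i < j) :
    lowerOf y i j = 0 := by
  simp [lowerOf, not_le.mpr h]

/-- The coordinates of the lower triangular matrices with positive diagonal. -/
def posDiag (n : ℕ) : Set (WeakLower n → ℝ) := {y | ∀ i : Fin n, 0 < y ⟨(i, i), le_rfl⟩}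

theorem lowerOf_diag_pos {n : ℕ} {y : WeakLower n → ℝ} (hy : y ∈ posDiag n) (i : Fin n) :
    0 < lowerOf y i i := by
  rw [lowerOf_of_le y le_rfl]
  exact hy i

theorem det_lowerOf {n : ℕ} (y : WeakLower n → ℝ) : (lowerOf y).det = ∏ i, lowerOf y i i :=
  Matrix.det_of_isLowerTriangular _ fun _ _ h => lowerOf_of_lt y h

theorem det_lowerOf_pos {n : ℕ} {y : WeakLower n → ℝ} (hy : y ∈ posDiag n) :
    0 < (lowerOf y).det := by
  rw [det_lowerOf]
  exact Finset.prod_pos fun i _ => lowerOf_diag_pos hy i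

theorem lowerOf_injective {n : ℕ} : Function.Injective (lowerOf (n := n)) := by
  intro y y' h
  ext ⟨⟨i, j⟩, hij⟩
  have := congrFun (congrFun h i) j
  rwa [lowerOf_of_le y hij, lowerOf_of_le y' hij] at this

/-- Uniqueness of the Cholesky factor. -/
theorem cholesky_unique {n : ℕ} {y y' : WeakLower n → ℝ} (hy : y ∈ posDiag n)
    (hy' : y' ∈ posDiag n) (h : lowerOf y * (lowerOf y)ᵀ = lowerOf y' * (lowerOf y')ᵀ) :
    y = y' := by
  apply lowerOf_injective
  have key : ∀ j i, j ≤ i → lowerOf y i j = lowerOf y' i j := by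
    intro j
    induction j using WellFoundedLT.induction with
    | ind j ih =>
      -- in the `(i, j)` entry of the hypothesis all terms but the `j`-th agree or vanish
      have e : ∀ i, j ≤ i → lowerOf y i j * lowerOf y j j = lowerOf y' i j * lowerOf y' j j := by
        intro i hij
        have hs : ∑ k, (lowerOf y i k * lowerOf y j k - lowerOf y' i k * lowerOf y' j k) = 0 := by
          have := congrFun (congrFun h i) j
          simp only [Matrix.mul_apply, Matrix.transpose_apply] at this
          rw [Finset.sum_sub_distrib, this, sub_self]
        rw [Finset.sum_eq_single j, sub_eq_zero] at hs
        · exact hs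
        · intro k _ hk
          rcases lt_or_gt_of_ne hk with hk | hk
          · rw [ih k hk i (hk.le.trans hij), ih k hk j hk.le, sub_self]
          · rw [lowerOf_of_lt y hk, lowerOf_of_lt y' hk]
            simp
        · simp
      have hd : lowerOf y j j = lowerOf y' j j := by
        have := e j le_rfl
        rwa [mul_self_inj (lowerOf_diag_pos hy j).le (lowerOf_diag_pos hy' j).le] at this
      intro i hij
      have := e i hij
      rw [hd] at this
      exact mul_right_cancel₀ (lowerOf_diag_pos hy' j).ne' this
  ext i j
  rcases le_or_gt j i with hij | hij
  · exact key j i hij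
  · rw [lowerOf_of_lt y hij, lowerOf_of_lt y' hij]

theorem det_sq_of_mem_orthogonalSet {n : ℕ} {U : Matrix (Fin n) (Fin n) ℝ}
    (hU : U ∈ orthogonalSet n) : U.det * U.det = 1 := by
  have : Uᵀ * U = 1 := hU
  simpa using congrArg Matrix.det this

theorem abs_det_of_mem_orthogonalSet {n : ℕ} {U : Matrix (Fin n) (Fin n) ℝ}
    (hU : U ∈ orthogonalSet n) : |U.det| = 1 := by
  rw [← sq_eq_sq₀ (abs_nonneg _) zero_le_one, sq_abs, sq, det_sq_of_mem_orthogonalSet hU, one_pow]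

/-- QR decomposition with a positive diagonal; the triangular factor is written as `Lᵀ`. -/
theorem exists_qr {n : ℕ} (X : Matrix (Fin n) (Fin n) ℝ) (hX : X.det ≠ 0) :
    ∃ U ∈ orthogonalSet n, ∃ y ∈ posDiag n, X = U * (lowerOf y)ᵀ := by
  classical
  let f : Fin n → EuclideanSpace ℝ (Fin n) := fun j => WithLp.toLp 2 fun i => X i j
  let b := InnerProductSpace.gramSchmidtOrthonormalBasis (𝕜 := ℝ) (by simp) f
  let R : Matrix (Fin n) (Fin n) ℝ := Matrix.of fun i j => inner ℝ (b i) (f j)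
  let B : Matrix (Fin n) (Fin n) ℝ := Matrix.of fun i j => b j i
  have hBR : X = B * R := by
    ext i j
    have := congrArg (fun v : EuclideanSpace ℝ (Fin n) => v i) (b.sum_repr' (f j))
    simp only [WithLp.ofLp_sum, WithLp.ofLp_smul, Finset.sum_apply, Pi.smul_apply,
      smul_eq_mul] at this
    rw [Matrix.mul_apply]
    change f j i = _
    rw [← this]
    exact Finset.sum_congr rfl fun k _ => mul_comm _ _
  have hB : Bᵀ * B = 1 := by
    ext i j
    have h := orthonormal_iff_ite.mp b.orthonormal i j
    rw [PiLp.inner_apply] at h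
    rw [Matrix.mul_apply, Matrix.one_apply, ← h]
    exact Finset.sum_congr rfl fun k _ => mul_comm _ _
  have hR : R.IsUpperTriangular := fun i j h =>
    InnerProductSpace.gramSchmidtOrthonormalBasis_inv_triangular _ f h
  have hRd : ∀ i, R i i ≠ 0 := by
    have : R.det ≠ 0 := by
      intro h0
      rw [hBR, Matrix.det_mul, h0, mul_zero] at hX
      exact hX rfl
    rw [Matrix.det_of_isUpperTriangular hR] at this
    exact fun i => Finset.prod_ne_zero_iff.mp this i (Finset.mem_univ i)
  -- the signs of the diagonal of `R` are moved into the orthogonal factor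
  let s : Fin n → ℝ := fun i => if 0 < R i i then 1 else -1
  have hs : ∀ i, s i * s i = 1 := by
    intro i
    by_cases h : 0 < R i i <;> simp [s, h]
  have hsR : ∀ i, 0 < s i * R i i := by
    intro i
    by_cases h : 0 < R i i
    · simp [s, h]
    · have : R i i < 0 := lt_of_le_of_ne (not_lt.mp h) (hRd i)
      simp [s, h, this]
  let D := Matrix.diagonal s
  have hD : D * D = 1 := by
    simp only [D, Matrix.diagonal_mul_diagonal, hs]
    exact Matrix.diagonal_one
  refine ⟨B * D, ?_, fun p => s p.1.2 * R p.1.2 p.1.1, fun i => hsR i, ?_⟩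
  · change (B * D)ᵀ * (B * D) = 1
    rw [Matrix.transpose_mul, Matrix.mul_assoc, ← Matrix.mul_assoc Bᵀ, hB, Matrix.one_mul]
    simpa [D] using hD
  · have : (lowerOf fun p : WeakLower n => s p.1.2 * R p.1.2 p.1.1)ᵀ = D * R := by
      ext i j
      rw [Matrix.transpose_apply, Matrix.diagonal_mul]
      rcases le_or_gt i j with h | h
      · rw [lowerOf_of_le _ h]
      · rw [lowerOf_of_lt _ h, hR h, mul_zero]
    rw [this, Matrix.mul_assoc, ← Matrix.mul_assoc D, hD, Matrix.one_mul, hBR]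

theorem transpose_mul_self_of_qr {n : ℕ} {U : Matrix (Fin n) (Fin n) ℝ}
    (hU : U ∈ orthogonalSet n) (y : WeakLower n → ℝ) :
    (U * (lowerOf y)ᵀ)ᵀ * (U * (lowerOf y)ᵀ) = lowerOf y * (lowerOf y)ᵀ := by
  have : Uᵀ * U = 1 := hU
  rw [Matrix.transpose_mul, Matrix.transpose_transpose, Matrix.mul_assoc, ← Matrix.mul_assoc Uᵀ,
    this, Matrix.one_mul]

theorem qr_unique {n : ℕ} {U U' : Matrix (Fin n) (Fin n) ℝ} (hU : U ∈ orthogonalSet n)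
    (hU' : U' ∈ orthogonalSet n) {y y' : WeakLower n → ℝ} (hy : y ∈ posDiag n)
    (hy' : y' ∈ posDiag n) (h : U * (lowerOf y)ᵀ = U' * (lowerOf y')ᵀ) : U = U' ∧ y = y' := by
  have hyy : y = y' := by
    apply cholesky_unique hy hy'
    rw [← transpose_mul_self_of_qr hU, h, transpose_mul_self_of_qr hU']
  subst hyy
  have hu : IsUnit (lowerOf y)ᵀ := by
    rw [Matrix.isUnit_iff_isUnit_det, Matrix.det_transpose]
    exact (det_lowerOf_pos hy).ne'.isUnit
  exact ⟨hu.mul_left_injective h, rfl⟩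

open scoped MatrixOrder in
theorem exists_cholesky {n : ℕ} {S : Matrix (Fin n) (Fin n) ℝ} (hS : S.PosDef) :
    ∃ y ∈ posDiag n, S = lowerOf y * (lowerOf y)ᵀ := by
  obtain ⟨X, hX⟩ : ∃ X : Matrix (Fin n) (Fin n) ℝ, S = Xᵀ * X :=
    ⟨CFC.sqrt S, by
      have h := (Matrix.nonneg_iff_posSemidef.mp (CFC.sqrt_nonneg S)).isHermitian
      rw [← Matrix.conjTranspose_eq_transpose_of_trivial, h.eq, CFC.sqrt_mul_sqrt_self S
        hS.posSemidef.nonneg]⟩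
  have hdet : X.det ≠ 0 := by
    intro h
    have := hS.det_pos
    rw [hX, Matrix.det_mul, h, mul_zero] at this
    exact this.false
  obtain ⟨U, hU, y, hy, h⟩ := exists_qr X hdet
  exact ⟨y, hy, by rw [hX, h, transpose_mul_self_of_qr hU]⟩

theorem posDef_lowerOf_mul_transpose {n : ℕ} {y : WeakLower n → ℝ} (hy : y ∈ posDiag n) :
    (lowerOf y * (lowerOf y)ᵀ).PosDef := by
  have hu : IsUnit (lowerOf y) := by
    rw [Matrix.isUnit_iff_isUnit_det]
    exact (det_lowerOf_pos hy).ne'.isUnit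
  rw [← Matrix.conjTranspose_eq_transpose_of_trivial]
  exact Matrix.PosDef.mul_conjTranspose_self _ (Matrix.vecMul_injective_of_isUnit hu)

/-! ### Determinants of the differentials -/

theorem Matrix.det_eq_prod_diag_of_key {m α : Type*} [Fintype m] [DecidableEq m] [LinearOrder α]
    (M : Matrix m m ℝ) (key : m → α) (hkey : Function.Injective key)
    (h : ∀ i j, key i < key j → M i j = 0) : M.det = ∏ i, M i i := by
  let _ : LinearOrder m := LinearOrder.lift' key hkey
  exact Matrix.det_of_isLowerTriangular M fun i j hij => h i j hij

theorem LinearMap.det_eq_det_fst_comp_inl {ι κ : Type*} [Fintype ι] [DecidableEq ι]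
    [Fintype κ] [DecidableEq κ] (f : ((ι → ℝ) × (κ → ℝ)) →ₗ[ℝ] ((ι → ℝ) × (κ → ℝ)))
    (hf : ∀ b, f (0, b) = (0, b)) :
    LinearMap.det f = LinearMap.det (LinearMap.fst ℝ _ _ ∘ₗ f ∘ₗ LinearMap.inl ℝ _ _) := by
  let e₁ := Pi.basisFun ℝ ι
  let e₂ := Pi.basisFun ℝ κ
  rw [← LinearMap.det_toMatrix (e₁.prod e₂), ← LinearMap.det_toMatrix e₁,
    ← Matrix.fromBlocks_toBlocks (LinearMap.toMatrix (e₁.prod e₂) (e₁.prod e₂) f)]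
  have h12 : (LinearMap.toMatrix (e₁.prod e₂) (e₁.prod e₂) f).toBlocks₁₂ = 0 := by
    ext i j
    simp [Matrix.toBlocks₁₂, LinearMap.toMatrix_apply, hf]
  have h22 : (LinearMap.toMatrix (e₁.prod e₂) (e₁.prod e₂) f).toBlocks₂₂ = 1 := by
    ext i j
    simp [Matrix.toBlocks₂₂, LinearMap.toMatrix_apply, hf, e₂, Matrix.one_apply, Pi.single_apply]
  rw [h12, h22, Matrix.det_fromBlocks_zero₁₂, Matrix.det_one, mul_one]
  congr 1
  ext i j
  simp [Matrix.toBlocks₁₁, LinearMap.toMatrix_apply]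

/-- Coordinates on the space of all square matrices: the entries below the diagonal, and the
entries on and above it (stored as those of the transpose). -/
abbrev Coord (n : ℕ) : Type := (StrictLower n → ℝ) × (WeakLower n → ℝ)

/-- The linear isomorphism reading off the coordinates of a matrix. -/
def coordEquiv (n : ℕ) : Matrix (Fin n) (Fin n) ℝ ≃ₗ[ℝ] Coord n where
  toFun X := (fun p => X p.1.1 p.1.2, fun p => X p.1.2 p.1.1)
  invFun z := Matrix.of fun i j => if h : j < i then z.1 ⟨(i, j), h⟩ else
    z.2 ⟨(j, i), not_lt.mp h⟩
  map_add' _ _ := rfl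
  map_smul' _ _ := rfl
  left_inv X := by
    ext i j
    by_cases h : j < i <;> simp
  right_inv z := by
    ext ⟨⟨i, j⟩, h⟩
    · simp [show j < i from h]
    · simp [show ¬ i < j from not_lt.mpr h]

theorem coordEquiv_transpose_lowerOf {n : ℕ} (b : WeakLower n → ℝ) :
    coordEquiv n (lowerOf b)ᵀ = (0, b) := by
  ext ⟨⟨i, j⟩, h⟩
  · exact lowerOf_of_lt b h
  · exact lowerOf_of_le b h

/-- Left multiplication by `U` acts on the space of matrices with determinant `(det U) ^ n`. -/
theorem det_mulLeftLinearMap {n : ℕ} (U : Matrix (Fin n) (Fin n) ℝ) :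
    LinearMap.det (mulLeftLinearMap (Fin n) ℝ U) = U.det ^ n := by
  let e : Matrix (Fin n) (Fin n) ℝ ≃ₗ[ℝ] (Fin n → Fin n → ℝ) :=
    Matrix.transposeLinearEquiv (Fin n) (Fin n) ℝ ℝ
  rw [← LinearMap.det_conj _ e]
  have : e.toLinearMap ∘ₗ mulLeftLinearMap (Fin n) ℝ U ∘ₗ e.symm.toLinearMap =
      LinearMap.pi fun i => (Matrix.toLin' U) ∘ₗ LinearMap.proj i := by
    refine LinearMap.ext fun Y => ?_
    rfl
  rw [this, LinearMap.det_pi]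
  simp

/-- The determinant of `X ↦ X Lᵀ` restricted to the entries below the diagonal, precomposed with
a linear map `Ω`. Since `L` is lower triangular, these entries of `X Lᵀ` only involve entries of
`X` below the diagonal. -/
theorem det_strictLower_mul_transpose {n : ℕ}
    (Ω : (StrictLower n → ℝ) →ₗ[ℝ] Matrix (Fin n) (Fin n) ℝ) (y : WeakLower n → ℝ)
    (g : (StrictLower n → ℝ) →ₗ[ℝ] (StrictLower n → ℝ))
    (hg : ∀ a p, g a p = (Ω a * (lowerOf y)ᵀ) p.1.1 p.1.2) :
    LinearMap.det g = (Matrix.of fun q p : StrictLower n => Ω (Pi.single q 1) p.1.1 p.1.2).det *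
      ∏ p : StrictLower n, lowerOf y p.1.2 p.1.2 := by
  let P : Matrix (StrictLower n) (StrictLower n) ℝ :=
    Matrix.of fun p r => if r.1.1 = p.1.1 then lowerOf y p.1.2 r.1.2 else 0
  have hP : P.det = ∏ p : StrictLower n, lowerOf y p.1.2 p.1.2 := by
    rw [Matrix.det_eq_prod_diag_of_key P (fun p => toLex (p.1.2, p.1.1))]
    · simp [P]
    · rintro ⟨⟨i, j⟩, h⟩ ⟨⟨k, l⟩, h'⟩ e
      simp only [EmbeddingLike.apply_eq_iff_eq, Prod.mk.injEq] at e
      simp [e.1, e.2]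
    · rintro ⟨⟨i, j⟩, h⟩ ⟨⟨k, l⟩, h'⟩ e
      simp only [Prod.Lex.toLex_lt_toLex] at e
      by_cases hk : k = i
      · rcases e with e | e
        · simp [P, lowerOf_of_lt y e]
        · exact absurd e.2 (by simp [hk])
      · simp [P, hk]
  rw [← LinearMap.det_toMatrix', ← hP, ← Matrix.det_transpose (Matrix.of _), mul_comm,
    ← Matrix.det_mul]
  congr 1
  ext p q
  rw [LinearMap.toMatrix'_apply, Matrix.mul_apply, hg, Matrix.mul_apply]
  have hpq : (fun j => if j = q then (1 : ℝ) else 0) = Pi.single q 1 := by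
    ext j
    simp [Pi.single_apply]
  simp only [Matrix.transpose_apply, Matrix.of_apply, P, ite_mul, zero_mul]
  rw [Finset.sum_ite, Finset.sum_const_zero, add_zero]
  symm
  -- the pairs `r` in the row of `p` correspond to the columns `k` before the diagonal
  have hlt : ∀ k ∉ Finset.univ.filter (· < p.1.1),
      Ω (Pi.single q 1) p.1.1 k * lowerOf y p.1.2 k = 0 := by
    intro k hk
    rw [lowerOf_of_lt y (p.2.trans_le (by simpa using hk)), mul_zero]
  rw [← Finset.sum_subset (Finset.subset_univ _) fun k _ hk => hlt k hk]
  refine Finset.sum_bij (fun r _ => r.1.2) ?_ ?_ ?_ ?_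
  · intro r hr
    have := r.2
    simp only [Finset.mem_filter, Finset.mem_univ, true_and] at hr ⊢
    rwa [hr] at this
  · intro r hr r' hr' e
    simp only [Finset.mem_filter, Finset.mem_univ, true_and] at hr hr'
    exact Subtype.ext (Prod.ext (hr.trans hr'.symm) e)
  · intro k hk
    exact ⟨⟨(p.1.1, k), by simpa using hk⟩, by simp, rfl⟩
  · intro r hr
    simp only [Finset.mem_filter, Finset.mem_univ, true_and] at hr
    rw [hr, mul_comm]

/-- The Jacobian of `(x, y) ↦ φ(x) Lᵀ`, with `U = φ(x)`, with `D` the differential of `φ` and with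
`L` the lower triangular matrix of `y`. Multiplication by `U` preserves volume, and `Uᵀ` turns the
differential into a block triangular map. -/
theorem abs_det_qr_differential {n : ℕ} {U : Matrix (Fin n) (Fin n) ℝ} (hU : U ∈ orthogonalSet n)
    (D : (StrictLower n → ℝ) →ₗ[ℝ] Matrix (Fin n) (Fin n) ℝ) {y : WeakLower n → ℝ}
    (hy : y ∈ posDiag n) (f : Coord n →ₗ[ℝ] Coord n)
    (hf : ∀ a b, f (a, b) = coordEquiv n (D a * (lowerOf y)ᵀ + U * (lowerOf b)ᵀ)) :
    |LinearMap.det f| = |wedgeForm U fun q => D (Pi.single q 1)| *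
      ∏ p : StrictLower n, lowerOf y p.1.2 p.1.2 := by
  have hUU : U * Uᵀ = 1 := mul_eq_one_comm.mp hU
  let e := coordEquiv n
  let L := e.toLinearMap ∘ₗ mulLeftLinearMap (Fin n) ℝ U ∘ₗ e.symm.toLinearMap
  let L' := e.toLinearMap ∘ₗ mulLeftLinearMap (Fin n) ℝ Uᵀ ∘ₗ e.symm.toLinearMap
  have hfac : f = L ∘ₗ (L' ∘ₗ f) := by
    refine LinearMap.ext fun z => ?_
    simp [L, L', ← Matrix.mul_assoc, hUU]
  have hL : |LinearMap.det L| = 1 := by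
    simp only [L]
    rw [LinearMap.det_conj, det_mulLeftLinearMap, abs_pow, abs_det_of_mem_orthogonalSet hU,
      one_pow]
  have hg : ∀ a b, (L' ∘ₗ f) (a, b) =
      coordEquiv n (Uᵀ * D a * (lowerOf y)ᵀ + (lowerOf b)ᵀ) := by
    intro a b
    have hU' : Uᵀ * U = 1 := hU
    simp [L', e, hf, Matrix.mul_add, ← Matrix.mul_assoc, hU']
  have hg0 : ∀ b, (L' ∘ₗ f) (0, b) = (0, b) := by
    intro b
    rw [hg, map_zero, Matrix.mul_zero, Matrix.zero_mul, zero_add, coordEquiv_transpose_lowerOf]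
  rw [hfac, LinearMap.det_comp, abs_mul, hL, one_mul, LinearMap.det_eq_det_fst_comp_inl _ hg0,
    det_strictLower_mul_transpose (mulLeftLinearMap (Fin n) ℝ Uᵀ ∘ₗ D) y, abs_mul,
    abs_of_pos (Finset.prod_pos fun p _ => lowerOf_diag_pos hy _), wedgeForm_apply]
  · rfl
  · intro a p
    have h0 : lowerOf (0 : WeakLower n → ℝ) = 0 := by
      ext i j
      simp [lowerOf]
    simp only [LinearMap.comp_apply, LinearMap.inl_apply, LinearMap.fst_apply] at hg ⊢
    rw [hg, h0, Matrix.transpose_zero, add_zero]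
    rfl

/-- The Jacobian of `y ↦ L Lᵀ`. -/
theorem det_cholesky_differential {n : ℕ} (y : WeakLower n → ℝ)
    (g : (WeakLower n → ℝ) →ₗ[ℝ] (WeakLower n → ℝ))
    (hg : ∀ b p, g b p = (lowerOf b * (lowerOf y)ᵀ + lowerOf y * (lowerOf b)ᵀ) p.1.1 p.1.2) :
    LinearMap.det g = 2 ^ n * ∏ p : WeakLower n, lowerOf y p.1.2 p.1.2 := by
  rw [← LinearMap.det_toMatrix']
  -- the only nonzero entry of the matrix of a basis vector
  have hs : ∀ (q : WeakLower n) (i k : Fin n), lowerOf (Pi.single q (1 : ℝ)) i k =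
      if i = q.1.1 ∧ k = q.1.2 then 1 else 0 := by
    intro q i k
    rcases le_or_gt k i with h | h
    · rw [lowerOf_of_le _ h, Pi.single_apply]
      congr 1
      simp [Subtype.ext_iff, Prod.ext_iff]
    · rw [lowerOf_of_lt _ h, if_neg]
      rintro ⟨rfl, rfl⟩
      exact absurd q.2 (not_le.mpr h)
  have hent : ∀ p q : WeakLower n, LinearMap.toMatrix' g p q =
      (if p.1.1 = q.1.1 then lowerOf y p.1.2 q.1.2 else 0) +
      (if p.1.2 = q.1.1 then lowerOf y p.1.1 q.1.2 else 0) := by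
    intro p q
    have hpq : (fun j => if j = q then (1 : ℝ) else 0) = Pi.single q 1 := by
      ext j
      simp [Pi.single_apply]
    rw [LinearMap.toMatrix'_apply, hg]
    simp only [Matrix.add_apply, Matrix.mul_apply, Matrix.transpose_apply, hs, ite_and, ite_mul,
      one_mul, zero_mul, mul_ite, mul_one, mul_zero]
    congr 1
    · by_cases h : p.1.1 = q.1.1 <;> simp [h]
    · by_cases h : p.1.2 = q.1.1 <;> simp [h]
  rw [Matrix.det_eq_prod_diag_of_key _ (fun p : WeakLower n => toLex (p.1.2, p.1.1))]
  · have hd : ∀ p : WeakLower n, LinearMap.toMatrix' g p p =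
        (if p.1.2 = p.1.1 then 2 else 1) * lowerOf y p.1.2 p.1.2 := by
      intro p
      rw [hent]
      by_cases h : p.1.2 = p.1.1
      · simp only [h, if_true]
        ring
      · simp [h]
    simp only [hd, Finset.prod_mul_distrib]
    congr 1
    rw [Finset.prod_ite, Finset.prod_const, Finset.prod_const_one, mul_one]
    congr 1
    rw [← Fintype.card_subtype]
    refine (Fintype.card_congr (β := Fin n) ⟨fun p => p.1.1.1, fun i => ⟨⟨(i, i), le_rfl⟩, rfl⟩,
      ?_, fun _ => rfl⟩).trans (Fintype.card_fin n)
    rintro ⟨⟨⟨i, j⟩, h⟩, h'⟩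
    have : j = i := h'
    subst this
    rfl
  · rintro ⟨⟨i, j⟩, h⟩ ⟨⟨k, l⟩, h'⟩ e
    simp only [EmbeddingLike.apply_eq_iff_eq, Prod.mk.injEq] at e
    simp [e.1, e.2]
  · rintro ⟨⟨i, j⟩, h⟩ ⟨⟨k, l⟩, h'⟩ e
    change j ≤ i at h
    change l ≤ k at h'
    rw [hent]
    simp only [Prod.Lex.toLex_lt_toLex] at e ⊢
    rcases e with e | ⟨rfl, e⟩
    · rw [lowerOf_of_lt y e]
      by_cases hjk : j = k
      · exact absurd h' (by rw [← hjk]; exact not_le.mpr e)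
      · simp [hjk]
    · simp [e.ne, (h.trans_lt e).ne]

/-! ### The measure obtained from the QR decomposition -/

noncomputable section

instance matrixBorelSpace (n : ℕ) : BorelSpace (Matrix (Fin n) (Fin n) ℝ) :=
  inferInstanceAs (BorelSpace (Fin n → Fin n → ℝ))

instance matrixPolishSpace (n : ℕ) : PolishSpace (Matrix (Fin n) (Fin n) ℝ) :=
  inferInstanceAs (PolishSpace (Fin n → Fin n → ℝ))

theorem continuous_coordEquiv (n : ℕ) : Continuous (coordEquiv n) :=
  LinearMap.continuous_of_finiteDimensional (coordEquiv n).toLinearMap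

theorem continuous_coordEquiv_symm (n : ℕ) : Continuous (coordEquiv n).symm :=
  LinearMap.continuous_of_finiteDimensional (coordEquiv n).symm.toLinearMap

theorem continuous_lowerOf (n : ℕ) : Continuous (lowerOf (n := n)) := by
  refine continuous_matrix fun i j => ?_
  rcases le_or_gt j i with h | h
  · simp only [lowerOf_of_le _ h]
    exact continuous_apply _
  · simp only [lowerOf_of_lt _ h]
    exact continuous_const

theorem isClosed_orthogonalSet (n : ℕ) : IsClosed (orthogonalSet n) :=
  isClosed_eq (continuous_id.matrix_transpose.matrix_mul continuous_id) continuous_const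

theorem isOpen_posDiag (n : ℕ) : IsOpen (posDiag n) := by
  simp only [posDiag, Set.ofPred_forall]
  exact isOpen_iInter_of_finite fun i => isOpen_lt continuous_const (continuous_apply _)

/-- The sum of the squares of the coordinates of a matrix. -/
def coordNormSq {n : ℕ} (z : Coord n) : ℝ := ∑ p, z.1 p ^ 2 + ∑ p, z.2 p ^ 2

theorem coordNormSq_coordEquiv {n : ℕ} (X : Matrix (Fin n) (Fin n) ℝ) :
    coordNormSq (coordEquiv n X) = (Xᵀ * X).trace := by
  have h1 : (Xᵀ * X).trace = ∑ p : Fin n × Fin n, X p.1 p.2 ^ 2 := by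
    rw [Fintype.sum_prod_type_right]
    simp [Matrix.trace, Matrix.mul_apply, sq]
  have h2 : ∑ p : WeakLower n, (coordEquiv n X).2 p ^ 2 =
      ∑ p : {p : Fin n × Fin n // ¬ p.2 < p.1}, X p.1.1 p.1.2 ^ 2 := by
    refine Fintype.sum_equiv ((Equiv.prodComm _ _).subtypeEquiv fun p => not_lt.symm) _ _
      fun p => rfl
  rw [h1, coordNormSq, h2,
    ← Fintype.sum_subtype_add_sum_subtype (fun p : Fin n × Fin n => p.2 < p.1)]
  rfl

theorem trace_lowerOf_mul_transpose {n : ℕ} (y : WeakLower n → ℝ) :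
    (lowerOf y * (lowerOf y)ᵀ).trace = ∑ p, y p ^ 2 := by
  have := coordNormSq_coordEquiv (lowerOf y)ᵀ
  rw [coordEquiv_transpose_lowerOf, Matrix.transpose_transpose] at this
  rw [← this]
  simp [coordNormSq]

/-- The (not normalized) Gaussian measure with density `exp (- tr (Xᵀ X))` on the space of matrices,
in the coordinates of `coordEquiv`. -/
def gaussMeasure (n : ℕ) : Measure (Coord n) :=
  volume.withDensity fun z => ENNReal.ofReal (Real.exp (-coordNormSq z))

/-- The map `(U, L) ↦ U Lᵀ` from orthogonal matrices and lower triangular matrices with positive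
diagonal. -/
def qrMap (n : ℕ) (z : orthogonalSet n × posDiag n) : Coord n :=
  coordEquiv n (z.1.1 * (lowerOf z.2.1)ᵀ)

/-- By the Lusin–Souslin theorem, since the QR decomposition is unique. -/
theorem measurableEmbedding_qrMap (n : ℕ) : MeasurableEmbedding (qrMap n) := by
  have : PolishSpace (orthogonalSet n) := (isClosed_orthogonalSet n).polishSpace
  have : PolishSpace (posDiag n) := (isOpen_posDiag n).polishSpace
  refine Continuous.measurableEmbedding ?_ ?_
  · refine (continuous_coordEquiv n).comp
      (Continuous.matrix_mul ?_ (Continuous.matrix_transpose ?_))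
    · exact continuous_subtype_val.comp continuous_fst
    · exact (continuous_lowerOf n).comp (continuous_subtype_val.comp continuous_snd)
  · rintro ⟨⟨U, hU⟩, ⟨y, hy⟩⟩ ⟨⟨U', hU'⟩, ⟨y', hy'⟩⟩ h
    obtain ⟨rfl, rfl⟩ := qr_unique hU hU' hy hy' ((coordEquiv n).injective h)
    rfl

theorem range_qrMap (n : ℕ) : Set.range (qrMap n) = {z | ((coordEquiv n).symm z).det ≠ 0} := by
  ext z
  constructor
  · rintro ⟨⟨⟨U, hU⟩, ⟨y, hy⟩⟩, rfl⟩
    have h1 : U.det ≠ 0 := left_ne_zero_of_mul_eq_one (det_sq_of_mem_orthogonalSet hU)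
    simp [qrMap, h1, (det_lowerOf_pos hy).ne']
  · intro hz
    obtain ⟨U, hU, y, hy, h⟩ := exists_qr _ hz
    exact ⟨(⟨U, hU⟩, ⟨y, hy⟩), by simp [qrMap, ← h]⟩

/-- The distribution of the orthogonal factor of a Gaussian matrix. It is not normalized, and it is
defined without choosing a factor of singular matrices, which are simply left out. -/
def qrMeasure (n : ℕ) : Measure (Matrix (Fin n) (Fin n) ℝ) :=
  ((gaussMeasure n).comap (qrMap n)).map fun z => z.1.1

theorem qrMeasure_apply {n : ℕ} {A : Set (Matrix (Fin n) (Fin n) ℝ)} (hA : MeasurableSet A) :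
    qrMeasure n A = gaussMeasure n (qrMap n '' {z | z.1.1 ∈ A}) := by
  have hm : Measurable fun z : orthogonalSet n × posDiag n => z.1.1 :=
    measurable_subtype_coe.comp measurable_fst
  rw [qrMeasure, Measure.map_apply hm hA, (measurableEmbedding_qrMap n).comap_apply]
  rfl

/-! ### Local parametrizations -/

namespace IsLocalParametrization

variable {n : ℕ} {W : Set (StrictLower n → ℝ)}
  {φ : (StrictLower n → ℝ) → Matrix (Fin n) (Fin n) ℝ}

theorem continuousOn (h : IsLocalParametrization W φ) : ContinuousOn φ W :=
  continuousOn_pi.2 fun i => continuousOn_pi.2 fun j => (h.smooth i j).continuousOn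

theorem differentiableAt (h : IsLocalParametrization W φ) {x : StrictLower n → ℝ} (hx : x ∈ W)
    (i j : Fin n) : DifferentiableAt ℝ (fun x => φ x i j) x :=
  ((h.smooth i j).differentiableOn (by simp)).differentiableAt (h.isOpen.mem_nhds hx)

theorem measurableSet_image (h : IsLocalParametrization W φ) {B : Set (StrictLower n → ℝ)}
    (hBW : B ⊆ W) (hB : MeasurableSet B) : MeasurableSet (φ '' B) :=
  hB.image_of_continuousOn_injOn (h.continuousOn.mono hBW) (h.injOn.mono hBW)

theorem measurableSet_preimage_inter (h : IsLocalParametrization W φ)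
    {A : Set (Matrix (Fin n) (Fin n) ℝ)} (hA : MeasurableSet A) : MeasurableSet (φ ⁻¹' A ∩ W) := by
  have hm : Measurable (W.domRestrict φ) :=
    (continuousOn_iff_continuous_domRestrict.mp h.continuousOn).measurable
  have := h.isOpen.measurableSet.subtype_image (hm hA)
  convert this using 1
  ext x
  simp [and_comm]

theorem aemeasurable_wedgeDensity (h : IsLocalParametrization W φ) :
    AEMeasurable (wedgeDensity φ) (volume.restrict W) := by
  have hφ : ∀ i j, AEMeasurable (fun x => φ x i j) (volume.restrict W) := fun i j =>
    (h.smooth i j).continuousOn.aemeasurable h.isOpen.measurableSet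
  have hd : ∀ q i j, Measurable fun x => partialMatrix φ x q i j := fun q i j =>
    measurable_fderiv_apply_const ℝ (fun y => φ y i j) _
  unfold wedgeDensity
  simp only [wedgeForm_apply, Matrix.det_apply, Matrix.of_apply, Matrix.mul_apply,
    Matrix.transpose_apply]
  refine AEMeasurable.ennreal_ofReal (AEMeasurable.abs ?_)
  refine Finset.aemeasurable_fun_sum _ fun σ _ => AEMeasurable.const_smul ?_ _
  refine Finset.aemeasurable_fun_prod _ fun p _ => ?_
  exact Finset.aemeasurable_fun_sum _ fun k _ => (hφ _ _).mul (hd _ _ _).aemeasurable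

/-- The differential of `(x, y) ↦ φ(x) Lᵀ`, by the product rule. -/
theorem hasFDerivAt_qr (h : IsLocalParametrization W φ) {x : StrictLower n → ℝ} (hx : x ∈ W)
    (y : WeakLower n → ℝ) : ∃ F : Coord n →L[ℝ] Coord n,
      HasFDerivAt (fun z : Coord n => coordEquiv n (φ z.1 * (lowerOf z.2)ᵀ)) F (x, y) ∧
      ∀ a b, F (a, b) = coordEquiv n
        ((Matrix.of fun i j => fderiv ℝ (fun y => φ y i j) x a) * (lowerOf y)ᵀ +
          φ x * (lowerOf b)ᵀ) := by
  have hl : ∀ i j : Fin n, ∃ l : Coord n →L[ℝ] ℝ,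
      HasFDerivAt (fun z : Coord n => lowerOf z.2 i j) l (x, y) ∧
      ∀ a b, l (a, b) = lowerOf b i j := by
    intro i j
    rcases le_or_gt j i with hij | hij
    · let l : Coord n →L[ℝ] ℝ := (ContinuousLinearMap.proj (R := ℝ) (φ := fun _ => ℝ)
        (⟨(i, j), hij⟩ : WeakLower n)).comp (ContinuousLinearMap.snd ℝ _ _)
      refine ⟨l, ?_, fun a b => (lowerOf_of_le b hij).symm⟩
      simp only [lowerOf_of_le _ hij]
      exact l.hasFDerivAt
    · refine ⟨0, ?_, fun a b => (lowerOf_of_lt b hij).symm⟩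
      simp only [lowerOf_of_lt _ hij]
      exact hasFDerivAt_const _ _
  choose l hl hl' using hl
  have hφ : ∀ i j, HasFDerivAt (fun z : Coord n => φ z.1 i j)
      ((fderiv ℝ (fun y => φ y i j) x).comp
        (ContinuousLinearMap.fst ℝ (StrictLower n → ℝ) (WeakLower n → ℝ))) (x, y) := by
    intro i j
    have h1 : HasFDerivAt (fun y => φ y i j) (fderiv ℝ (fun y => φ y i j) x) (x, y).1 :=
      (h.differentiableAt hx i j).hasFDerivAt
    exact h1.comp (x, y) hasFDerivAt_fst
  have hent : ∀ i j, HasFDerivAt (fun z : Coord n => (φ z.1 * (lowerOf z.2)ᵀ) i j)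
      (∑ k, (φ x i k • l j k + lowerOf y j k •
        (fderiv ℝ (fun y => φ y i k) x).comp
        (ContinuousLinearMap.fst ℝ (StrictLower n → ℝ) (WeakLower n → ℝ)))) (x, y) := by
    intro i j
    simp only [Matrix.mul_apply, Matrix.transpose_apply]
    exact HasFDerivAt.fun_sum fun k _ => (hφ i k).fun_mul (hl j k)
  refine ⟨_, HasFDerivAt.prodMk (hasFDerivAt_pi.2 fun p => hent p.1.1 p.1.2)
    (hasFDerivAt_pi.2 fun p => hent p.1.2 p.1.1), fun a b => ?_⟩
  have hval : ∀ i j, (∑ k, (φ x i k • l j k + lowerOf y j k •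
      (fderiv ℝ (fun y => φ y i k) x).comp
        (ContinuousLinearMap.fst ℝ (StrictLower n → ℝ) (WeakLower n → ℝ)))) (a, b) =
      ((Matrix.of fun i j => fderiv ℝ (fun y => φ y i j) x a) * (lowerOf y)ᵀ +
          φ x * (lowerOf b)ᵀ) i j := by
    intro i j
    simp only [sum_apply, add_apply,
      smul_apply, hl', ContinuousLinearMap.comp_apply,
      ContinuousLinearMap.coe_fst', smul_eq_mul, Matrix.add_apply, Matrix.mul_apply,
      Matrix.transpose_apply, Matrix.of_apply, ← Finset.sum_add_distrib]
    exact Finset.sum_congr rfl fun k _ => by ring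
  refine Prod.ext (funext fun p => ?_) (funext fun p => ?_)
  · exact hval p.1.1 p.1.2
  · exact hval p.1.2 p.1.1

end IsLocalParametrization

/-- The weight that the triangular factors carry in the QR decomposition of Gaussian matrices. -/
def triangularWeight {n : ℕ} (y : WeakLower n → ℝ) : ℝ :=
  (∏ p : StrictLower n, lowerOf y p.1.2 p.1.2) * Real.exp (-∑ p, y p ^ 2)

theorem continuous_triangularWeight (n : ℕ) : Continuous (triangularWeight (n := n)) := by
  refine Continuous.mul (continuous_finsetProd _ fun p _ => ?_) (by fun_prop)
  exact (continuous_lowerOf n).matrix_elem _ _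

/-- The total weight of the triangular factors. -/
def triangularMass (n : ℕ) : ENNReal :=
  ∫⁻ y in posDiag n, ENNReal.ofReal (triangularWeight y)

/-- The change of variables `(x, y) ↦ φ(x) Lᵀ` identifies the distribution of the orthogonal factor
with the measure of the wedge product, up to a constant factor. -/
theorem qrMeasure_image {n : ℕ} {W : Set (StrictLower n → ℝ)}
    {φ : (StrictLower n → ℝ) → Matrix (Fin n) (Fin n) ℝ} (h : IsLocalParametrization W φ)
    {B : Set (StrictLower n → ℝ)} (hBW : B ⊆ W) (hB : MeasurableSet B) :
    qrMeasure n (φ '' B) = (∫⁻ x in B, wedgeDensity φ x) * triangularMass n := by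
  let F : Coord n → Coord n := fun z => coordEquiv n (φ z.1 * (lowerOf z.2)ᵀ)
  have hS : MeasurableSet (B ×ˢ posDiag n) := hB.prod (isOpen_posDiag n).measurableSet
  have himg : qrMap n '' {z | z.1.1 ∈ φ '' B} = F '' (B ×ˢ posDiag n) := by
    ext z
    constructor
    · rintro ⟨⟨⟨U, hU⟩, ⟨y, hy⟩⟩, ⟨x, hx, rfl⟩, rfl⟩
      exact ⟨(x, y), ⟨hx, hy⟩, rfl⟩
    · rintro ⟨⟨x, y⟩, ⟨hx, hy⟩, rfl⟩
      exact ⟨(⟨φ x, h.mapsTo (hBW hx)⟩, ⟨y, hy⟩), ⟨x, hx, rfl⟩, rfl⟩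
  have hinj : Set.InjOn F (B ×ˢ posDiag n) := by
    rintro ⟨x, y⟩ ⟨hx, hy⟩ ⟨x', y'⟩ ⟨hx', hy'⟩ e
    obtain ⟨e₁, e₂⟩ := qr_unique (h.mapsTo (hBW hx)) (h.mapsTo (hBW hx')) hy hy'
      ((coordEquiv n).injective e)
    exact Prod.ext (h.injOn (hBW hx) (hBW hx') e₁) e₂
  have hder : ∀ z ∈ B ×ˢ posDiag n, HasFDerivWithinAt F (fderiv ℝ F z) (B ×ˢ posDiag n) z := by
    rintro ⟨x, y⟩ ⟨hx, hy⟩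
    obtain ⟨F', hF', -⟩ := h.hasFDerivAt_qr (hBW hx) y
    exact hF'.differentiableAt.hasFDerivAt.hasFDerivWithinAt
  have hval : ∀ z ∈ B ×ˢ posDiag n, ENNReal.ofReal |(fderiv ℝ F z).det| *
      ENNReal.ofReal (Real.exp (-coordNormSq (F z))) =
      wedgeDensity φ z.1 * ENNReal.ofReal (triangularWeight z.2) := by
    rintro ⟨x, y⟩ ⟨hx, hy⟩
    obtain ⟨F', hF', hF''⟩ := h.hasFDerivAt_qr (hBW hx) y
    have hU := h.mapsTo (hBW hx)
    let D : (StrictLower n → ℝ) →ₗ[ℝ] Matrix (Fin n) (Fin n) ℝ :=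
      { toFun := fun a => Matrix.of fun i j => fderiv ℝ (fun y => φ y i j) x a
        map_add' := fun a b => by ext i j; simp
        map_smul' := fun c a => by ext i j; simp }
    have hdet : |(fderiv ℝ F (x, y)).det| = |wedgeForm (φ x) (partialMatrix φ x)| *
        ∏ p : StrictLower n, lowerOf y p.1.2 p.1.2 := by
      rw [HasFDerivAt.fderiv hF']
      exact abs_det_qr_differential hU D hy F'.toLinearMap hF''
    have hnorm : coordNormSq (F (x, y)) = ∑ p, y p ^ 2 := by
      rw [coordNormSq_coordEquiv, transpose_mul_self_of_qr hU, trace_lowerOf_mul_transpose]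
    rw [hdet, hnorm, wedgeDensity, ← ENNReal.ofReal_mul (by rw [← hdet]; exact abs_nonneg _),
      ← ENNReal.ofReal_mul (abs_nonneg _), triangularWeight, mul_assoc]
  have : (volume : Measure (Coord n)).IsAddHaarMeasure := Measure.prod.instIsAddHaarMeasure _ _
  rw [qrMeasure_apply (h.measurableSet_image hBW hB), himg, gaussMeasure, withDensity_apply' _ _,
    lintegral_image_eq_lintegral_abs_det_fderiv_mul volume hS hder hinj,
    setLIntegral_congr_fun hS hval, Measure.volume_eq_prod, ← Measure.prod_restrict,
    lintegral_prod_mul (f := wedgeDensity φ) (g := fun y => ENNReal.ofReal (triangularWeight y))]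
  · rfl
  · exact h.aemeasurable_wedgeDensity.mono_measure (Measure.restrict_mono hBW le_rfl)
  · exact (continuous_triangularWeight n).measurable.ennreal_ofReal.aemeasurable

/-! ### The measure of the wedge product -/

theorem patchMeasure_apply {n : ℕ} {W : Set (StrictLower n → ℝ)}
    {φ : (StrictLower n → ℝ) → Matrix (Fin n) (Fin n) ℝ} (h : IsLocalParametrization W φ)
    {A : Set (Matrix (Fin n) (Fin n) ℝ)} (hA : MeasurableSet A) :
    patchMeasure W φ A = ∫⁻ x in φ ⁻¹' A ∩ W, wedgeDensity φ x := by
  have hφ : AEMeasurable φ ((volume.restrict W).withDensity (wedgeDensity φ)) :=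
    (h.continuousOn.aemeasurable h.isOpen.measurableSet).mono_ac
      (withDensity_absolutelyContinuous _ _)
  rw [patchMeasure, Measure.map_apply_of_aemeasurable hφ hA, withDensity_apply' _ _,
    Measure.restrict_restrict' h.isOpen.measurableSet]

theorem patchMeasure_le_wedgeMeasure {n : ℕ} {W : Set (StrictLower n → ℝ)}
    {φ : (StrictLower n → ℝ) → Matrix (Fin n) (Fin n) ℝ} (h : IsLocalParametrization W φ) :
    patchMeasure W φ ≤ wedgeMeasure n :=
  le_iSup_of_le W (le_iSup_of_le φ (le_iSup_of_le h le_rfl))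

theorem triangularMass_mul_patchMeasure {n : ℕ} {W : Set (StrictLower n → ℝ)}
    {φ : (StrictLower n → ℝ) → Matrix (Fin n) (Fin n) ℝ} (h : IsLocalParametrization W φ)
    {A : Set (Matrix (Fin n) (Fin n) ℝ)} (hA : MeasurableSet A) :
    patchMeasure W φ A * triangularMass n = qrMeasure n (A ∩ φ '' W) := by
  rw [patchMeasure_apply h hA, ← qrMeasure_image h Set.inter_subset_right
    (h.measurableSet_preimage_inter hA), Set.image_preimage_inter]

/-- Each patch measure is, up to the normalization, the restriction of `qrMeasure` to a range. -/
theorem wedgeMeasure_le {n : ℕ} (h0 : triangularMass n ≠ 0) (htop : triangularMass n ≠ ⊤) :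
    wedgeMeasure n ≤ (triangularMass n)⁻¹ • qrMeasure n := by
  refine iSup_le fun W => iSup_le fun φ => iSup_le fun h => Measure.le_iff.mpr fun A hA => ?_
  rw [Measure.smul_apply, smul_eq_mul, ← ENNReal.div_eq_inv_mul,
    ENNReal.le_div_iff_mul_le (Or.inl h0) (Or.inl htop), triangularMass_mul_patchMeasure h hA]
  exact measure_mono Set.inter_subset_left

theorem wedgeMeasure_image {n : ℕ} (h0 : triangularMass n ≠ 0) (htop : triangularMass n ≠ ⊤)
    {W : Set (StrictLower n → ℝ)}
    {φ : (StrictLower n → ℝ) → Matrix (Fin n) (Fin n) ℝ} (h : IsLocalParametrization W φ)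
    {B : Set (StrictLower n → ℝ)} (hBW : B ⊆ W) (hB : MeasurableSet B) :
    wedgeMeasure n (φ '' B) = ∫⁻ x in B, wedgeDensity φ x := by
  apply le_antisymm
  · refine (wedgeMeasure_le h0 htop _).trans ?_
    rw [Measure.smul_apply, smul_eq_mul, qrMeasure_image h hBW hB, mul_comm, mul_assoc,
      ENNReal.mul_inv_cancel h0 htop, mul_one]
  · refine le_trans (le_of_eq ?_) (patchMeasure_le_wedgeMeasure h _)
    rw [patchMeasure_apply h (h.measurableSet_image hBW hB)]
    congr 2
    ext x
    constructor
    · exact fun hx => ⟨⟨x, hx, rfl⟩, hBW hx⟩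
    · rintro ⟨⟨x', hx', e⟩, hx⟩
      rwa [← h.injOn (hBW hx') hx e]

/-- On the range of a local parametrization, the wedge measure is the normalized distribution of
the orthogonal factor of a Gaussian matrix. -/
theorem wedgeMeasure_eq_of_subset_image {n : ℕ} (h0 : triangularMass n ≠ 0)
    (htop : triangularMass n ≠ ⊤)
    {W : Set (StrictLower n → ℝ)}
    {φ : (StrictLower n → ℝ) → Matrix (Fin n) (Fin n) ℝ} (h : IsLocalParametrization W φ)
    {A : Set (Matrix (Fin n) (Fin n) ℝ)} (hA : MeasurableSet A) (hAW : A ⊆ φ '' W) :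
    wedgeMeasure n A = ((triangularMass n)⁻¹ • qrMeasure n) A := by
  refine le_antisymm (wedgeMeasure_le h0 htop A) ?_
  refine le_trans (le_of_eq ?_) (patchMeasure_le_wedgeMeasure h A)
  have := triangularMass_mul_patchMeasure h hA
  rw [Set.inter_eq_left.mpr hAW] at this
  rw [Measure.smul_apply, smul_eq_mul, ← this, mul_comm, mul_assoc, ENNReal.mul_inv_cancel h0 htop,
    mul_one]

/-! ### Cayley charts -/

/-- The skew-symmetric matrix with the given entries below the diagonal. -/
def skewOf (n : ℕ) : (StrictLower n → ℝ) →ₗ[ℝ] Matrix (Fin n) (Fin n) ℝ where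
  toFun x := Matrix.of fun i j =>
    if h : j < i then x ⟨(i, j), h⟩ else if h : i < j then -x ⟨(j, i), h⟩ else 0
  map_add' x y := by
    ext i j
    simp only [Matrix.of_apply, Matrix.add_apply, Pi.add_apply]
    split_ifs <;> ring
  map_smul' c x := by
    ext i j
    simp only [Matrix.of_apply, Matrix.smul_apply, Pi.smul_apply, smul_eq_mul, RingHom.id_apply]
    split_ifs <;> ring

theorem skewOf_apply_lower {n : ℕ} (x : StrictLower n → ℝ) (p : StrictLower n) :
    skewOf n x p.1.1 p.1.2 = x p := by
  have h : p.1.2 < p.1.1 := p.2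
  simp [skewOf, h]

theorem skewOf_injective (n : ℕ) : Function.Injective (skewOf n) := by
  intro x y h
  ext p
  rw [← skewOf_apply_lower x, h, skewOf_apply_lower]

theorem skewOf_transpose {n : ℕ} (x : StrictLower n → ℝ) : (skewOf n x)ᵀ = -skewOf n x := by
  ext i j
  rcases lt_trichotomy i j with h | rfl | h
  · simp [skewOf, h, h.not_gt]
  · simp [skewOf]
  · simp [skewOf, h, h.not_gt]

theorem exists_skewOf_eq {n : ℕ} {A : Matrix (Fin n) (Fin n) ℝ} (hA : Aᵀ = -A) :
    ∃ x, skewOf n x = A := by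
  have hA' : ∀ i j, A j i = -A i j := fun i j => congrFun (congrFun hA i) j
  refine ⟨fun p => A p.1.1 p.1.2, ?_⟩
  ext i j
  rcases lt_trichotomy i j with h | rfl | h
  · simp [skewOf, h, h.not_gt, hA' i j]
  · have := hA' i i
    simp only [skewOf, LinearMap.coe_mk, AddHom.coe_mk, Matrix.of_apply, lt_irrefl, dite_false]
    linarith
  · simp [skewOf, h]

/-- A skew-symmetric `A` satisfies `v ⬝ᵥ A v = 0`, so `-1` is not an eigenvalue of `A`. -/
theorem isUnit_det_one_add_skewOf {n : ℕ} (x : StrictLower n → ℝ) :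
    IsUnit (1 + skewOf n x).det := by
  rw [isUnit_iff_ne_zero]
  intro h
  obtain ⟨v, hv, hv0⟩ := Matrix.exists_mulVec_eq_zero_iff.mpr h
  apply hv
  have h1 : v ⬝ᵥ (skewOf n x *ᵥ v) = 0 := by
    have : v ⬝ᵥ (skewOf n x *ᵥ v) = -(v ⬝ᵥ (skewOf n x *ᵥ v)) := by
      conv_lhs => rw [Matrix.dotProduct_mulVec, ← Matrix.mulVec_transpose, skewOf_transpose,
        Matrix.neg_mulVec, neg_dotProduct, dotProduct_comm]
    linarith
  have h2 := congrArg (v ⬝ᵥ ·) hv0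
  simp only [Matrix.add_mulVec, Matrix.one_mulVec, dotProduct_add, h1, add_zero,
    dotProduct_zero] at h2
  exact dotProduct_self_eq_zero.mp h2

/-- The Cayley parametrization `A ↦ U₀ (1 - A) (1 + A)⁻¹ = U₀ (2 (1 + A)⁻¹ - 1)` of a
neighbourhood of `U₀` by skew-symmetric matrices `A`. -/
def cayley {n : ℕ} (U₀ : Matrix (Fin n) (Fin n) ℝ) (x : StrictLower n → ℝ) :
    Matrix (Fin n) (Fin n) ℝ :=
  U₀ * ((2 : ℝ) • (1 + skewOf n x)⁻¹ - 1)

theorem contDiff_det {m E : Type*} [Fintype m] [DecidableEq m] [NormedAddCommGroup E]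
    [NormedSpace ℝ E] {M : E → Matrix m m ℝ} (h : ∀ i j, ContDiff ℝ ∞ fun x => M x i j) :
    ContDiff ℝ ∞ fun x => (M x).det := by
  simp only [Matrix.det_apply]
  exact ContDiff.sum fun σ _ => (contDiff_prod fun i _ => h _ _).const_smul _

theorem contDiff_inv {m E : Type*} [Fintype m] [DecidableEq m] [NormedAddCommGroup E]
    [NormedSpace ℝ E] {M : E → Matrix m m ℝ} (h : ∀ i j, ContDiff ℝ ∞ fun x => M x i j)
    (hM : ∀ x, (M x).det ≠ 0) (i j : m) : ContDiff ℝ ∞ fun x => (M x)⁻¹ i j := by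
  simp only [Matrix.inv_def, Ring.inverse_eq_inv', Matrix.smul_apply, smul_eq_mul,
    Matrix.adjugate_apply]
  refine ((contDiff_det h).inv hM).mul (contDiff_det fun k l => ?_)
  by_cases hk : k = j
  · subst hk
    simpa using contDiff_const
  · simpa [Matrix.updateRow_apply, hk] using h k l

theorem contDiff_cayley {n : ℕ} (U₀ : Matrix (Fin n) (Fin n) ℝ) (i j : Fin n) :
    ContDiff ℝ ∞ fun x => cayley U₀ x i j := by
  have hA : ∀ i j, ContDiff ℝ ∞ fun x => (1 + skewOf n x) i j := by
    intro i j
    have := ((Matrix.entryLinearMap ℝ ℝ i j ∘ₗ skewOf n).toContinuousLinearMap).contDiff (n := ∞)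
    exact contDiff_const.add this
  simp only [cayley, Matrix.mul_apply, Matrix.sub_apply, Matrix.smul_apply]
  refine ContDiff.sum fun k _ => contDiff_const.mul (ContDiff.sub ?_ contDiff_const)
  exact (contDiff_inv hA (fun x => (isUnit_det_one_add_skewOf x).ne_zero) k j).const_smul _

theorem one_add_skewOf_mul_one_add_cayley {n : ℕ} {U₀ : Matrix (Fin n) (Fin n) ℝ}
    (hU₀ : U₀ ∈ orthogonalSet n) (x : StrictLower n → ℝ) :
    (1 + skewOf n x) * (1 + U₀ᵀ * cayley U₀ x) = (2 : ℝ) • 1 := by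
  have h : U₀ᵀ * U₀ = 1 := hU₀
  rw [cayley, ← Matrix.mul_assoc, h, Matrix.one_mul, add_sub_cancel, Matrix.mul_smul,
    Matrix.mul_nonsing_inv _ (isUnit_det_one_add_skewOf x)]

theorem mul_mem_orthogonalSet {n : ℕ} {U V : Matrix (Fin n) (Fin n) ℝ} (hU : U ∈ orthogonalSet n)
    (hV : V ∈ orthogonalSet n) : U * V ∈ orthogonalSet n := by
  have h : Uᵀ * U = 1 := hU
  have h' : Vᵀ * V = 1 := hV
  change (U * V)ᵀ * (U * V) = 1
  rw [Matrix.transpose_mul, Matrix.mul_assoc, ← Matrix.mul_assoc Uᵀ, h, Matrix.one_mul, h']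

theorem cayley_mem {n : ℕ} {U₀ : Matrix (Fin n) (Fin n) ℝ} (hU₀ : U₀ ∈ orthogonalSet n)
    (x : StrictLower n → ℝ) : cayley U₀ x ∈ orthogonalSet n := by
  refine mul_mem_orthogonalSet hU₀ ?_
  set A := skewOf n x with hA
  have hu := isUnit_det_one_add_skewOf x
  rw [← hA] at hu
  have h1 : (2 : ℝ) • (1 + A)⁻¹ - 1 = (1 - A) * (1 + A)⁻¹ := by
    have : (1 : Matrix (Fin n) (Fin n) ℝ) - A = (2 : ℝ) • 1 - (1 + A) := by
      rw [two_smul]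
      abel
    rw [this, Matrix.sub_mul, Matrix.mul_nonsing_inv _ hu, Matrix.smul_mul, Matrix.one_mul]
  have h2 : (1 - A)ᵀ * (1 - A) = (1 + A)ᵀ * (1 + A) := by
    rw [Matrix.transpose_sub, Matrix.transpose_add, Matrix.transpose_one, skewOf_transpose]
    noncomm_ring
  change ((2 : ℝ) • (1 + A)⁻¹ - 1)ᵀ * ((2 : ℝ) • (1 + A)⁻¹ - 1) = 1
  rw [h1, Matrix.transpose_mul, Matrix.mul_assoc, ← Matrix.mul_assoc (1 - A)ᵀ, h2,
    Matrix.mul_assoc, Matrix.mul_nonsing_inv _ hu, Matrix.mul_one, ← Matrix.transpose_mul,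
    Matrix.mul_nonsing_inv _ hu, Matrix.transpose_one]

theorem isLocalParametrization_cayley {n : ℕ} {U₀ : Matrix (Fin n) (Fin n) ℝ}
    (hU₀ : U₀ ∈ orthogonalSet n) : IsLocalParametrization Set.univ (cayley U₀) where
  isOpen := isOpen_univ
  mapsTo x _ := cayley_mem hU₀ x
  smooth i j := (contDiff_cayley U₀ i j).contDiffOn
  injOn := by
    intro x _ y _ h
    apply skewOf_injective n
    have hx := one_add_skewOf_mul_one_add_cayley hU₀ x
    have hy := one_add_skewOf_mul_one_add_cayley hU₀ y
    rw [h, ← hy] at hx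
    have hu : IsUnit (1 + U₀ᵀ * cayley U₀ y) := by
      rw [Matrix.isUnit_iff_isUnit_det, isUnit_iff_ne_zero]
      intro h0
      have := congrArg Matrix.det hy
      rw [Matrix.det_mul, h0, mul_zero, Matrix.det_smul, Matrix.det_one, mul_one] at this
      exact (pow_ne_zero _ two_ne_zero) this.symm
    exact add_left_cancel (hu.mul_left_injective hx)
  immersion := by
    intro x _
    rw [Fintype.linearIndependent_iff]
    intro c hc
    have hφ : ∀ i j, fderiv ℝ (fun y => cayley U₀ y i j) x c = 0 := by
      intro i j
      have h1 := congrFun (congrFun hc i) j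
      simp only [Matrix.sum_apply, Matrix.smul_apply, partialMatrix, Matrix.of_apply,
        Matrix.zero_apply] at h1
      rw [← h1]
      conv_lhs => rw [pi_eq_sum_univ' c]
      rw [map_sum]
      refine Finset.sum_congr rfl fun q _ => ?_
      rw [map_smul]
    -- differentiate `(1 + A) (1 + U₀ᵀ φ) = 2` in the direction `c`, along which `φ` is stationary
    have hA : ∀ i k, HasFDerivAt (fun y => (1 + skewOf n y) i k)
        ((Matrix.entryLinearMap ℝ ℝ i k ∘ₗ skewOf n).toContinuousLinearMap) x := by
      intro i k
      have := ((Matrix.entryLinearMap ℝ ℝ i k ∘ₗ skewOf n).toContinuousLinearMap).hasFDerivAt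
        (x := x)
      exact this.const_add _
    have hC : ∀ k j, HasFDerivAt (fun y => (1 + U₀ᵀ * cayley U₀ y) k j)
        (∑ l, U₀ᵀ k l • fderiv ℝ (fun y => cayley U₀ y l j) x) x := by
      intro k j
      simp only [Matrix.add_apply, Matrix.mul_apply]
      refine HasFDerivAt.const_add _ (HasFDerivAt.fun_sum fun l _ => ?_)
      exact (((contDiff_cayley U₀ l j).differentiable (by simp)).differentiableAt.hasFDerivAt
        ).const_mul _
    have hz : skewOf n c * (1 + U₀ᵀ * cayley U₀ x) = 0 := by
      ext i j
      have h1 := HasFDerivAt.fun_sum (u := Finset.univ) fun k _ => (hA i k).fun_mul (hC k j)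
      have hconst : (fun y => ∑ k, (1 + skewOf n y) i k * (1 + U₀ᵀ * cayley U₀ y) k j) =
          fun _ => ((2 : ℝ) • (1 : Matrix (Fin n) (Fin n) ℝ)) i j := by
        ext y
        rw [← one_add_skewOf_mul_one_add_cayley hU₀ y, Matrix.mul_apply]
      rw [hconst] at h1
      have h2 := congrArg (fun L => L c) (h1.unique (hasFDerivAt_const _ _))
      simp only [sum_apply, add_apply, smul_apply, hφ, smul_zero, Finset.sum_const_zero,
        zero_add, zero_apply] at h2
      rw [Matrix.mul_apply, Matrix.zero_apply, ← h2]
      exact Finset.sum_congr rfl fun k _ => mul_comm _ _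
    have hcz : skewOf n c = 0 := by
      have h1 : (1 + U₀ᵀ * cayley U₀ x) * ((1 / 2 : ℝ) • (1 + skewOf n x)) = 1 := by
        refine mul_eq_one_comm.mp ?_
        rw [Matrix.smul_mul, one_add_skewOf_mul_one_add_cayley hU₀, smul_smul]
        norm_num
      rw [← Matrix.mul_one (skewOf n c), ← h1, ← Matrix.mul_assoc, hz, Matrix.zero_mul]
    have := skewOf_injective n (hcz.trans (map_zero _).symm)
    exact fun q => congrFun this q

/-- The Cayley chart at `U₀` covers all orthogonal `U` such that `-1` is not an eigenvalue of
`U₀ᵀ U`. -/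
theorem mem_range_cayley {n : ℕ} {U₀ U : Matrix (Fin n) (Fin n) ℝ} (hU₀ : U₀ ∈ orthogonalSet n)
    (hU : U ∈ orthogonalSet n) (h : (1 + U₀ᵀ * U).det ≠ 0) : U ∈ Set.range (cayley U₀) := by
  have hU₀' : U₀ * U₀ᵀ = 1 := mul_eq_one_comm.mp hU₀
  set V := U₀ᵀ * U with hV
  have hVV : Vᵀ * V = 1 := by
    have hUU : Uᵀ * U = 1 := hU
    rw [hV, Matrix.transpose_mul, Matrix.transpose_transpose, Matrix.mul_assoc,
      ← Matrix.mul_assoc U₀, hU₀', Matrix.one_mul, hUU]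
  have hu : IsUnit (1 + V).det := h.isUnit
  have hT : ((1 + V)⁻¹)ᵀ = (1 + V)⁻¹ * V := by
    have h1 : ((1 + V)⁻¹)ᵀ * (1 + V)ᵀ = 1 := by
      rw [← Matrix.transpose_mul, Matrix.mul_nonsing_inv _ hu, Matrix.transpose_one]
    have h2 : (1 + V)ᵀ * V = 1 + V := by
      rw [Matrix.transpose_add, Matrix.transpose_one, Matrix.add_mul, hVV, Matrix.one_mul, add_comm]
    have h3 : ((1 + V)⁻¹)ᵀ * (1 + V) = V := by
      calc ((1 + V)⁻¹)ᵀ * (1 + V) = ((1 + V)⁻¹)ᵀ * ((1 + V)ᵀ * V) := by rw [h2]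
        _ = V := by rw [← Matrix.mul_assoc, h1, Matrix.one_mul]
    have h4 : (1 + V)⁻¹ * V = V * (1 + V)⁻¹ := by
      have h5 : (1 + V) * V = V * (1 + V) := by noncomm_ring
      calc (1 + V)⁻¹ * V = (1 + V)⁻¹ * (V * (1 + V)) * (1 + V)⁻¹ := by
            rw [Matrix.mul_assoc, Matrix.mul_assoc, Matrix.mul_nonsing_inv _ hu, Matrix.mul_one]
        _ = V * (1 + V)⁻¹ := by
            rw [← h5, ← Matrix.mul_assoc, Matrix.nonsing_inv_mul _ hu, Matrix.one_mul]
    rw [h4]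
    nth_rewrite 2 [← h3]
    rw [Matrix.mul_assoc, Matrix.mul_nonsing_inv _ hu, Matrix.mul_one]
  have hskew : ((2 : ℝ) • (1 + V)⁻¹ - 1)ᵀ = -((2 : ℝ) • (1 + V)⁻¹ - 1) := by
    have h1 : (1 + V)⁻¹ + (1 + V)⁻¹ * V = 1 := by
      nth_rewrite 1 [← Matrix.mul_one (1 + V)⁻¹]
      rw [← Matrix.mul_add, Matrix.nonsing_inv_mul _ hu]
    rw [Matrix.transpose_sub, Matrix.transpose_smul, hT, Matrix.transpose_one, ← sub_eq_zero]
    calc _ = (2 : ℝ) • ((1 + V)⁻¹ + (1 + V)⁻¹ * V) - (2 : ℝ) • (1 : Matrix (Fin n) (Fin n) ℝ) := by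
          rw [smul_add, two_smul ℝ (1 : Matrix (Fin n) (Fin n) ℝ)]
          abel
      _ = 0 := by rw [h1, sub_self]
  obtain ⟨x, hx⟩ := exists_skewOf_eq hskew
  refine ⟨x, ?_⟩
  have hinv : (1 + skewOf n x)⁻¹ = (1 / 2 : ℝ) • (1 + V) := by
    apply Matrix.inv_eq_right_inv
    rw [hx, add_sub_cancel, Matrix.smul_mul, Matrix.mul_smul, Matrix.nonsing_inv_mul _ hu, smul_smul]
    norm_num
  rw [cayley, hinv, smul_smul]
  norm_num
  rw [hV, ← Matrix.mul_assoc, hU₀', Matrix.one_mul]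

theorem exists_countable_cayley_cover (n : ℕ) : ∃ t ⊆ orthogonalSet n, t.Countable ∧
    orthogonalSet n = ⋃ U₀ ∈ t, cayley U₀ '' Set.univ := by
  have h : ∀ U₀ ∈ orthogonalSet n,
      {U | (1 + U₀ᵀ * U).det ≠ 0} ∈ nhdsWithin U₀ (orthogonalSet n) := by
    intro U₀ hU₀
    refine mem_nhdsWithin_of_mem_nhds (IsOpen.mem_nhds ?_ ?_)
    · exact isOpen_ne_fun (Continuous.matrix_det (continuous_const.add
        (continuous_const.matrix_mul continuous_id))) continuous_const
    · have h : U₀ᵀ * U₀ = 1 := hU₀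
      change (1 + U₀ᵀ * U₀).det ≠ 0
      rw [h, ← two_smul ℝ (1 : Matrix (Fin n) (Fin n) ℝ), Matrix.det_smul, Matrix.det_one, mul_one]
      exact pow_ne_zero _ two_ne_zero
  obtain ⟨t, hts, htc, ht⟩ := TopologicalSpace.countable_cover_nhdsWithin h
  refine ⟨t, hts, htc, Set.Subset.antisymm ?_ ?_⟩
  · intro U hU
    obtain ⟨U₀, h₀, h1⟩ := Set.mem_iUnion₂.mp (ht hU)
    obtain ⟨x, hx⟩ := mem_range_cayley (hts h₀) hU h1
    exact Set.mem_iUnion₂.mpr ⟨U₀, h₀, x, trivial, hx⟩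
  · refine Set.iUnion₂_subset fun U₀ h₀ => ?_
    rintro _ ⟨x, -, rfl⟩
    exact cayley_mem (hts h₀) x

/-! ### The total mass -/

/-- Singular matrices form a null set: each line `{X + t | t ∈ ℝ}` contains only finitely many. -/
theorem volume_singular_eq_zero (n : ℕ) :
    volume {z : Coord n | ((coordEquiv n).symm z).det = 0} = 0 := by
  set Z := {z : Coord n | ((coordEquiv n).symm z).det = 0} with hZ
  have : (volume : Measure (Coord n)).IsAddHaarMeasure := Measure.prod.instIsAddHaarMeasure _ _
  have hZm : MeasurableSet Z :=
    (isClosed_eq (continuous_coordEquiv_symm n).matrix_det continuous_const).measurableSet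
  let I := coordEquiv n 1
  let S : Set (Coord n × ℝ) := {w | w.1 + w.2 • I ∈ Z}
  have hSm : MeasurableSet S := by
    have : Measurable fun w : Coord n × ℝ => w.1 + w.2 • I := by fun_prop
    exact this hZm
  have h0 : ((volume : Measure (Coord n)).prod (volume : Measure ℝ)) S = 0 := by
    rw [Measure.measure_prod_null hSm]
    refine Filter.Eventually.of_forall fun z => ?_
    refine Set.Finite.measure_zero ?_ _
    let X := (coordEquiv n).symm z
    refine ((-X).charpoly.roots.toFinset.finite_toSet).subset fun t ht => ?_
    have ht' : ((coordEquiv n).symm (z + t • I)).det = 0 := ht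
    simp only [Finset.mem_coe, Multiset.mem_toFinset]
    rw [Polynomial.mem_roots (Matrix.charpoly_monic _).ne_zero, Polynomial.IsRoot,
      Matrix.eval_charpoly, ← ht']
    congr 1
    rw [map_add, map_smul]
    simp only [I, LinearEquiv.symm_apply_apply, X, sub_neg_eq_add, add_comm, Matrix.scalar_apply,
      Matrix.smul_one_eq_diagonal]
  rw [Measure.prod_apply_symm hSm] at h0
  have hsec : ∀ t : ℝ, volume ((fun z => (z, t)) ⁻¹' S) = volume Z := fun t =>
    measure_preimage_add_right volume (t • I) Z
  simp only [hsec, lintegral_const, Real.volume_univ] at h0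
  rcases mul_eq_zero.mp h0 with h | h
  · exact h
  · exact absurd h ENNReal.top_ne_zero

theorem qrMeasure_orthogonalSet (n : ℕ) :
    qrMeasure n (orthogonalSet n) = gaussMeasure n Set.univ := by
  rw [qrMeasure_apply (isClosed_orthogonalSet n).measurableSet]
  have h1 : {z : orthogonalSet n × posDiag n | z.1.1 ∈ orthogonalSet n} = Set.univ :=
    Set.eq_univ_of_forall fun z => z.1.2
  rw [h1, Set.image_univ, range_qrMap]
  refine measure_congr (Filter.eventuallyEq_univ.mpr ?_)
  refine (withDensity_absolutelyContinuous volume _) ?_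
  refine measure_mono_null (fun z hz => ?_) (volume_singular_eq_zero n)
  simpa using hz

/-- Countably many Cayley charts cover `O(n)`, and on each of them `wedgeMeasure` is the normalized
`qrMeasure`. -/
theorem orthogonalVolume_eq {n : ℕ} (h0 : triangularMass n ≠ 0) (htop : triangularMass n ≠ ⊤) :
    orthogonalVolume n = (triangularMass n)⁻¹ * gaussMeasure n Set.univ := by
  obtain ⟨t, hts, htc, ht⟩ := exists_countable_cayley_cover n
  have hr : (wedgeMeasure n).restrict (orthogonalSet n) =
      ((triangularMass n)⁻¹ • qrMeasure n).restrict (orthogonalSet n) := by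
    rw [ht, Measure.restrict_biUnion_congr htc]
    intro U₀ h₀
    have hp := isLocalParametrization_cayley (hts h₀)
    ext A hA
    rw [Measure.restrict_apply hA, Measure.restrict_apply hA]
    exact wedgeMeasure_eq_of_subset_image h0 htop hp
      (hA.inter (hp.measurableSet_image le_rfl MeasurableSet.univ)) Set.inter_subset_right
  rw [orthogonalVolume, ← Measure.restrict_apply_self, hr, Measure.restrict_apply_self,
    Measure.smul_apply, smul_eq_mul, qrMeasure_orthogonalSet]

/-! ### Integration over triangular matrices -/

theorem prod_weakLower {M : Type*} [CommMonoid M] {n : ℕ} (F : Fin n × Fin n → M) :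
    ∏ p : WeakLower n, F p = (∏ i, F (i, i)) * ∏ p : StrictLower n, F p := by
  have h1 : ∏ p : WeakLower n, F p = ∏ p : Fin n × Fin n, if p.2 ≤ p.1 then F p else 1 := by
    rw [← Finset.prod_filter]
    exact (Finset.prod_subtype _ (by simp) F).symm
  have h2 : ∏ p : StrictLower n, F p = ∏ p : Fin n × Fin n, if p.2 < p.1 then F p else 1 := by
    rw [← Finset.prod_filter]
    exact (Finset.prod_subtype _ (by simp) F).symm
  have h3 : ∏ i, F (i, i) = ∏ p : Fin n × Fin n, if p.1 = p.2 then F p else 1 := by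
    rw [Fintype.prod_prod_type]
    simp
  rw [h1, h2, h3, ← Finset.prod_mul_distrib]
  refine Finset.prod_congr rfl fun p _ => ?_
  rcases lt_trichotomy p.1 p.2 with h | h | h
  · simp [h.not_ge, h.ne, h.not_gt]
  · simp [h]
  · simp [h.le, h.ne', h]

theorem prod_strictLower {M : Type*} [CommMonoid M] {n : ℕ} (g : Fin n → M) :
    ∏ p : StrictLower n, g p.1.2 = ∏ j, g j ^ (n - 1 - (j : ℕ)) := by
  have h : ∏ p : StrictLower n, g p.1.2 =
      ∏ p : Fin n × Fin n, if p.2 < p.1 then g p.2 else 1 := by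
    rw [← Finset.prod_filter]
    exact (Finset.prod_subtype _ (by simp) fun p : Fin n × Fin n => g p.2).symm
  rw [h, Fintype.prod_prod_type_right]
  refine Finset.prod_congr rfl fun j _ => ?_
  rw [← Finset.prod_filter]
  refine (Finset.prod_const (g j)).trans ?_
  congr 1
  rw [← Fin.card_Ioi]
  congr 1
  ext i
  simp

/-- The factor that the coordinate `p` contributes to `triangularWeight`. On the diagonal it vanishes
off the positive half-line, which accounts for the restriction to `posDiag`. -/
def coordWeight {n : ℕ} (p : WeakLower n) (t : ℝ) : ℝ :=
  if p.1.1 = p.1.2 then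
    (Set.Ioi (0 : ℝ)).indicator (fun t => t ^ (n - 1 - (p.1.2 : ℕ)) * Real.exp (-t ^ 2)) t
  else Real.exp (-t ^ 2)

theorem indicator_triangularWeight {n : ℕ} (y : WeakLower n → ℝ) :
    (posDiag n).indicator triangularWeight y = ∏ p, coordWeight p (y p) := by
  by_cases hy : y ∈ posDiag n
  · have h1 : ∀ p : WeakLower n, coordWeight p (y p) =
        (if p.1.1 = p.1.2 then lowerOf y p.1.2 p.1.2 ^ (n - 1 - (p.1.2 : ℕ)) else 1) *
          Real.exp (-y p ^ 2) := by
      rintro ⟨⟨i, j⟩, hij⟩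
      by_cases h : i = j
      · subst h
        have := hy i
        simp [coordWeight, lowerOf_of_le y (le_refl i), this]
      · simp [coordWeight, h]
    rw [Set.indicator_of_mem hy, triangularWeight, prod_strictLower fun j => lowerOf y j j]
    simp only [h1]
    rw [Finset.prod_mul_distrib, ← Real.exp_sum, Finset.sum_neg_distrib,
      prod_weakLower fun p => if p.1 = p.2 then lowerOf y p.2 p.2 ^ (n - 1 - (p.2 : ℕ)) else 1]
    have h2 : ∏ p : StrictLower n, (if p.1.1 = p.1.2 then
        lowerOf y p.1.2 p.1.2 ^ (n - 1 - (p.1.2 : ℕ)) else 1) = 1 :=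
      Finset.prod_eq_one fun p _ => if_neg (show p.1.2 < p.1.1 from p.2).ne'
    simp [h2]
  · rw [Set.indicator_of_notMem hy]
    simp only [posDiag, Set.mem_ofPred_eq, not_forall] at hy
    obtain ⟨i, hi⟩ := hy
    symm
    refine Finset.prod_eq_zero (Finset.mem_univ ⟨(i, i), le_rfl⟩) ?_
    simp only [coordWeight, if_true]
    exact Set.indicator_of_notMem (by simpa using hi) _

theorem integrable_exp_neg_sq : Integrable fun t : ℝ => Real.exp (-t ^ 2) := by
  simpa using integrable_exp_neg_mul_sq (b := 1) one_pos

theorem integral_exp_neg_sq : ∫ t : ℝ, Real.exp (-t ^ 2) = √Real.pi := by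
  simpa using integral_gaussian 1

theorem integrable_coordWeight {n : ℕ} (p : WeakLower n) : Integrable (coordWeight p) := by
  unfold coordWeight
  split_ifs with h
  · refine Integrable.indicator ?_ measurableSet_Ioi
    have := integrable_rpow_mul_exp_neg_mul_sq (b := 1) one_pos
      (s := ((n - 1 - (p.1.2 : ℕ) : ℕ) : ℝ)) (by
        have : (0 : ℝ) ≤ ((n - 1 - (p.1.2 : ℕ) : ℕ) : ℝ) := Nat.cast_nonneg _
        linarith)
    simpa only [Real.rpow_natCast, neg_mul, one_mul] using this
  · exact integrable_exp_neg_sq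

theorem integral_coordWeight {n : ℕ} (p : WeakLower n) :
    ∫ t, coordWeight p t = if p.1.1 = p.1.2 then
      Real.Gamma ((((n - 1 - (p.1.2 : ℕ) : ℕ) : ℝ) + 1) / 2) / 2 else √Real.pi := by
  unfold coordWeight
  split_ifs with h
  · rw [integral_indicator measurableSet_Ioi]
    have := integral_rpow_mul_exp_neg_rpow (p := 2) (q := ((n - 1 - (p.1.2 : ℕ) : ℕ) : ℝ)) two_pos
      (by
        have : (0 : ℝ) ≤ ((n - 1 - (p.1.2 : ℕ) : ℕ) : ℝ) := Nat.cast_nonneg _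
        linarith)
    simp only [Real.rpow_natCast, Real.rpow_ofNat] at this
    rw [this]
    ring
  · exact integral_exp_neg_sq

theorem integrableOn_triangularWeight (n : ℕ) :
    IntegrableOn (triangularWeight (n := n)) (posDiag n) := by
  rw [← integrable_indicator_iff (isOpen_posDiag n).measurableSet,
    funext (indicator_triangularWeight (n := n))]
  exact Integrable.fintype_prod fun p => integrable_coordWeight p

theorem prod_gamma_reflect (n : ℕ) :
    ∏ i : Fin n, Real.Gamma ((((n - 1 - (i : ℕ) : ℕ) : ℝ) + 1) / 2) =
      ∏ k ∈ Finset.Icc 1 n, Real.Gamma ((k : ℝ) / 2) := by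
  rw [Fin.prod_univ_eq_prod_range (fun i => Real.Gamma ((((n - 1 - i : ℕ) : ℝ) + 1) / 2)) n,
    Finset.prod_range_reflect (fun i => Real.Gamma (((i : ℝ) + 1) / 2)) n,
    Finset.range_eq_Ico]
  have := Finset.prod_Ico_add' (fun k : ℕ => Real.Gamma ((k : ℝ) / 2)) 0 n 1
  push_cast at this
  rw [this]
  rfl

theorem prod_strictLower_const (n : ℕ) (c : ℝ) :
    ∏ _p : StrictLower n, c = c ^ (∑ i ∈ Finset.range n, i) := by
  rw [prod_strictLower fun _ => c, Finset.prod_pow_eq_pow_sum]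
  congr 1
  rw [Fin.sum_univ_eq_sum_range (fun i => n - 1 - i) n]
  exact Finset.sum_range_reflect (fun i => i) n

theorem integral_triangularWeight (n : ℕ) : ∫ y in posDiag n, triangularWeight y =
    (∏ k ∈ Finset.Icc 1 n, Real.Gamma ((k : ℝ) / 2)) / 2 ^ n *
      √Real.pi ^ (∑ i ∈ Finset.range n, i) := by
  rw [← integral_indicator (isOpen_posDiag n).measurableSet,
    funext (indicator_triangularWeight (n := n)),
    integral_fintype_prod_volume_eq_prod (fun p => coordWeight p)]
  simp only [integral_coordWeight]
  rw [prod_weakLower fun p => if p.1 = p.2 then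
      Real.Gamma ((((n - 1 - (p.2 : ℕ) : ℕ) : ℝ) + 1) / 2) / 2 else √Real.pi,
    ← prod_strictLower_const, ← prod_gamma_reflect]
  congr 1
  · simp [Finset.prod_div_distrib]
  · exact Finset.prod_congr rfl fun p _ => if_neg (show p.1.2 < p.1.1 from p.2).ne'

theorem integral_triangularWeight_pos (n : ℕ) : 0 < ∫ y in posDiag n, triangularWeight y := by
  rw [integral_triangularWeight]
  have h : 0 < ∏ k ∈ Finset.Icc 1 n, Real.Gamma ((k : ℝ) / 2) := by
    refine Finset.prod_pos fun k hk => Real.Gamma_pos_of_pos ?_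
    have : 0 < k := (Finset.mem_Icc.mp hk).1
    positivity
  have := Real.pi_pos
  positivity

theorem triangularMass_eq (n : ℕ) :
    triangularMass n = ENNReal.ofReal (∫ y in posDiag n, triangularWeight y) := by
  rw [triangularMass, ofReal_integral_eq_lintegral_ofReal (integrableOn_triangularWeight n)]
  refine (ae_restrict_iff' (isOpen_posDiag n).measurableSet).mpr (.of_forall fun y hy => ?_)
  exact mul_nonneg (Finset.prod_nonneg fun p _ => (lowerOf_diag_pos hy _).le) (Real.exp_pos _).le

theorem lintegral_exp_neg_sum_sq (ι : Type*) [Fintype ι] :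
    ∫⁻ y : ι → ℝ, ENNReal.ofReal (Real.exp (-∑ p, y p ^ 2)) =
      ENNReal.ofReal (∏ _p : ι, √Real.pi) := by
  have h : (fun y : ι → ℝ => Real.exp (-∑ p, y p ^ 2)) =
      fun y => ∏ p, (fun t : ℝ => Real.exp (-t ^ 2)) (y p) := by
    ext y
    rw [← Finset.sum_neg_distrib, Real.exp_sum]
  rw [← ofReal_integral_eq_lintegral_ofReal]
  · rw [h, integral_fintype_prod_volume_eq_prod (fun _ t => Real.exp (-t ^ 2))]
    simp only [integral_exp_neg_sq]
  · rw [h]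
    exact Integrable.fintype_prod fun _ => integrable_exp_neg_sq
  · exact .of_forall fun y => (Real.exp_pos _).le

theorem gaussMeasure_univ (n : ℕ) :
    gaussMeasure n Set.univ = ENNReal.ofReal (Real.pi ^ ((n : ℝ) ^ 2 / 2)) := by
  have h1 : ∀ z : Coord n, ENNReal.ofReal (Real.exp (-coordNormSq z)) =
      ENNReal.ofReal (Real.exp (-∑ p, z.1 p ^ 2)) *
        ENNReal.ofReal (Real.exp (-∑ p, z.2 p ^ 2)) := by
    intro z
    rw [← ENNReal.ofReal_mul (Real.exp_pos _).le, ← Real.exp_add, coordNormSq, neg_add]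
  rw [gaussMeasure, withDensity_apply' _ _, Measure.restrict_univ, lintegral_congr h1,
    Measure.volume_eq_prod,
    lintegral_prod_mul (f := fun x : StrictLower n → ℝ => ENNReal.ofReal (Real.exp (-∑ p, x p ^ 2)))
      (g := fun x : WeakLower n → ℝ => ENNReal.ofReal (Real.exp (-∑ p, x p ^ 2))),
    lintegral_exp_neg_sum_sq, lintegral_exp_neg_sum_sq, ← ENNReal.ofReal_mul (by positivity)]
  · congr 1
    rw [prod_weakLower fun _ => √Real.pi, prod_strictLower_const, Finset.prod_const,
      Finset.card_univ, Fintype.card_fin, ← pow_add, ← pow_add, Real.sqrt_eq_rpow,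
      ← Real.rpow_natCast, ← Real.rpow_mul Real.pi_pos.le]
    congr 1
    have h2 : (∑ i ∈ Finset.range n, i) + (n + ∑ i ∈ Finset.range n, i) = n ^ 2 := by
      have := Finset.sum_range_id_mul_two n
      rcases n with _ | n
      · simp
      · simp only [Nat.add_sub_cancel] at this
        nlinarith
    rw [h2]
    push_cast
    ring
  · exact (by fun_prop : Measurable fun x : StrictLower n → ℝ =>
      ENNReal.ofReal (Real.exp (-∑ p, x p ^ 2))).aemeasurable
  · exact (by fun_prop : Measurable fun x : WeakLower n → ℝ =>
      ENNReal.ofReal (Real.exp (-∑ p, x p ^ 2))).aemeasurable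

/-! ### The multivariate gamma function -/

theorem hasFDerivAt_lowerOf {n : ℕ} (y : WeakLower n → ℝ) (i j : Fin n) :
    HasFDerivAt (fun y : WeakLower n → ℝ => lowerOf y i j)
      (if h : j ≤ i then ContinuousLinearMap.proj (R := ℝ) (φ := fun _ => ℝ)
        (⟨(i, j), h⟩ : WeakLower n) else 0) y := by
  split_ifs with h
  · simp only [lowerOf_of_le _ h]
    exact ContinuousLinearMap.hasFDerivAt (ContinuousLinearMap.proj (R := ℝ) (φ := fun _ => ℝ)
        (⟨(i, j), h⟩ : WeakLower n))
  · simp only [lowerOf_of_lt _ (not_le.mp h)]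
    exact hasFDerivAt_const _ _

/-- The coordinates of the symmetric matrix `L Lᵀ`. -/
def choleskyMap (n : ℕ) (y : WeakLower n → ℝ) : WeakLower n → ℝ :=
  fun p => (lowerOf y * (lowerOf y)ᵀ) p.1.1 p.1.2

theorem symmetricOf_choleskyMap {n : ℕ} (y : WeakLower n → ℝ) :
    symmetricOf (choleskyMap n y) = lowerOf y * (lowerOf y)ᵀ := by
  have hsymm : ∀ i j, (lowerOf y * (lowerOf y)ᵀ) i j = (lowerOf y * (lowerOf y)ᵀ) j i := by
    intro i j
    simp [Matrix.mul_apply, mul_comm]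
  ext i j
  rcases le_total j i with h | h
  · simp [symmetricOf, choleskyMap, max_eq_left h, min_eq_right h]
  · simp [symmetricOf, choleskyMap, max_eq_right h, min_eq_left h, hsymm j i]

theorem hasFDerivAt_choleskyMap {n : ℕ} (y : WeakLower n → ℝ) :
    ∃ G : (WeakLower n → ℝ) →L[ℝ] (WeakLower n → ℝ), HasFDerivAt (choleskyMap n) G y ∧
      ∀ b p, G b p = (lowerOf b * (lowerOf y)ᵀ + lowerOf y * (lowerOf b)ᵀ) p.1.1 p.1.2 := by
  have hent := fun i j => HasFDerivAt.fun_sum (u := Finset.univ) fun k _ =>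
    (hasFDerivAt_lowerOf y i k).fun_mul (hasFDerivAt_lowerOf y j k)
  refine ⟨_, hasFDerivAt_pi.2 fun p => hent p.1.1 p.1.2, fun b p => ?_⟩
  have hval : ∀ i j : Fin n, (if h : j ≤ i then ContinuousLinearMap.proj (R := ℝ) (φ := fun _ => ℝ)
        (⟨(i, j), h⟩ : WeakLower n) else 0) b = lowerOf b i j := by
    intro i j
    split_ifs with h
    · exact (lowerOf_of_le b h).symm
    · exact (lowerOf_of_lt b (not_le.mp h)).symm
  simp only [ContinuousLinearMap.coe_pi', sum_apply, add_apply, smul_apply, hval, smul_eq_mul,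
    Matrix.add_apply, Matrix.mul_apply, Matrix.transpose_apply, ← Finset.sum_add_distrib]
  exact Finset.sum_congr rfl fun k _ => by ring

theorem image_choleskyMap (n : ℕ) :
    choleskyMap n '' posDiag n = {x : WeakLower n → ℝ | (symmetricOf x).PosDef} := by
  ext x
  constructor
  · rintro ⟨y, hy, rfl⟩
    change (symmetricOf _).PosDef
    rw [symmetricOf_choleskyMap]
    exact posDef_lowerOf_mul_transpose hy
  · intro hx
    obtain ⟨y, hy, h⟩ := exists_cholesky hx
    refine ⟨y, hy, funext fun p => ?_⟩
    rw [choleskyMap, ← h]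
    have hp : p.1.2 ≤ p.1.1 := p.2
    simp [symmetricOf, max_eq_left hp, min_eq_right hp]

/-- By the Cholesky change of variables, `Γ_n(n / 2)` is an integral over triangular matrices with
the weight that appears in the QR decomposition. -/
theorem multivariateGamma_half (n : ℕ) :
    multivariateGamma n ((n : ℝ) / 2) = 2 ^ n * ∫ y in posDiag n, triangularWeight y := by
  have hder : ∀ y ∈ posDiag n, HasFDerivWithinAt (choleskyMap n) (fderiv ℝ (choleskyMap n) y)
      (posDiag n) y := by
    intro y _
    obtain ⟨G, hG, -⟩ := hasFDerivAt_choleskyMap y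
    exact hG.differentiableAt.hasFDerivAt.hasFDerivWithinAt
  have hinj : Set.InjOn (choleskyMap n) (posDiag n) := by
    intro y hy y' hy' h
    apply cholesky_unique hy hy'
    rw [← symmetricOf_choleskyMap, h, symmetricOf_choleskyMap]
  rw [multivariateGamma, ← image_choleskyMap,
    integral_image_eq_integral_abs_det_fderiv_smul volume (isOpen_posDiag n).measurableSet hder
      hinj, ← integral_const_mul]
  refine setIntegral_congr_fun (isOpen_posDiag n).measurableSet fun y hy => ?_
  obtain ⟨G, hG, hG'⟩ := hasFDerivAt_choleskyMap y
  have hdet : (fderiv ℝ (choleskyMap n) y).det =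
      2 ^ n * ∏ p : WeakLower n, lowerOf y p.1.2 p.1.2 := by
    rw [hG.fderiv]
    exact det_cholesky_differential y G.toLinearMap hG'
  have hpos : 0 < ∏ i, lowerOf y i i := Finset.prod_pos fun i _ => lowerOf_diag_pos hy i
  have hpos' : 0 < ∏ p : StrictLower n, lowerOf y p.1.2 p.1.2 :=
    Finset.prod_pos fun i _ => lowerOf_diag_pos hy _
  -- `det (L Lᵀ) ^ (-1 / 2)` cancels the diagonal part of the Jacobian
  have hrpow : (lowerOf y * (lowerOf y)ᵀ).det ^ ((n : ℝ) / 2 - ((n : ℝ) + 1) / 2) =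
      (∏ i, lowerOf y i i)⁻¹ := by
    rw [Matrix.det_mul, Matrix.det_transpose, det_lowerOf, ← sq, ← Real.rpow_natCast,
      ← Real.rpow_mul hpos.le, ← Real.rpow_neg_one]
    congr 1
    push_cast
    ring
  simp only [symmetricOf_choleskyMap, trace_lowerOf_mul_transpose, hrpow, hdet, smul_eq_mul]
  rw [prod_weakLower fun p => lowerOf y p.2 p.2, abs_of_pos (by positivity), triangularWeight]
  field_simp

theorem mainTheorem2 (n : ℕ) :
    (∀ (W : Set (StrictLower n → ℝ)) (φ : (StrictLower n → ℝ) → Matrix (Fin n) (Fin n) ℝ),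
      IsLocalParametrization W φ → ∀ B : Set (StrictLower n → ℝ), B ⊆ W → MeasurableSet B →
        wedgeMeasure n (φ '' B) = ∫⁻ x in B, wedgeDensity φ x) ∧
    orthogonalVolume n =
      ENNReal.ofReal
        ((2 : ℝ) ^ n * Real.pi ^ ((n : ℝ) ^ 2 / 2) / multivariateGamma n ((n : ℝ) / 2)) ∧
    (2 : ℝ) ^ n * Real.pi ^ ((n : ℝ) ^ 2 / 2) / multivariateGamma n ((n : ℝ) / 2) =
      (2 : ℝ) ^ n * Real.pi ^ ((n : ℝ) * ((n : ℝ) + 1) / 4) /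
        ∏ k ∈ Finset.Icc 1 n, Real.Gamma ((k : ℝ) / 2) := by
  have hT := integral_triangularWeight_pos n
  have h0 : triangularMass n ≠ 0 := by
    rw [triangularMass_eq]
    exact (ENNReal.ofReal_pos.mpr hT).ne'
  have htop : triangularMass n ≠ ⊤ := by
    rw [triangularMass_eq]
    exact ENNReal.ofReal_ne_top
  refine ⟨fun W φ h B hBW hB => wedgeMeasure_image h0 htop h hBW hB, ?_, ?_⟩
  · rw [orthogonalVolume_eq h0 htop, triangularMass_eq, gaussMeasure_univ, multivariateGamma_half,
      ← ENNReal.ofReal_inv_of_pos hT, ← ENNReal.ofReal_mul (inv_nonneg.mpr hT.le)]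
    congr 1
    field_simp
  · have hG : 0 < ∏ k ∈ Finset.Icc 1 n, Real.Gamma ((k : ℝ) / 2) := by
      refine Finset.prod_pos fun k hk => Real.Gamma_pos_of_pos ?_
      have : 0 < k := (Finset.mem_Icc.mp hk).1
      positivity
    have hsum : ((∑ i ∈ Finset.range n, i : ℕ) : ℝ) = (n : ℝ) * ((n : ℝ) - 1) / 2 := by
      have h := congrArg (Nat.cast (R := ℝ)) (Finset.sum_range_id_mul_two n)
      rcases n with _ | n
      · simp
      · simp only [Nat.add_sub_cancel] at h
        push_cast at h ⊢
        linarith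
    have hpi : √Real.pi ^ (∑ i ∈ Finset.range n, i) *
        Real.pi ^ ((n : ℝ) * ((n : ℝ) + 1) / 4) = Real.pi ^ ((n : ℝ) ^ 2 / 2) := by
      rw [Real.sqrt_eq_rpow, ← Real.rpow_natCast, ← Real.rpow_mul Real.pi_pos.le,
        ← Real.rpow_add Real.pi_pos, hsum]
      congr 1
      ring
    have hs : 0 < √Real.pi ^ (∑ i ∈ Finset.range n, i) := by
      have := Real.pi_pos
      positivity
    rw [multivariateGamma_half, integral_triangularWeight, ← hpi]
    field_simp

end
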